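/- **Setting.** A game has players $[N]$, finite nonempty action sets $\mathcal A_i$, utilities $\mathcal U_i:\mathcal A=\prod_i\mathcal A_i\to[0,1]$, and a nonempty family $\mathcal S$ of nonempty coalitions $S\subseteq[N]$. Put $\mathcal A_C=\prod_{i\in C}\mathcal A_i$, $A=\max_i|\mathcal A_i|$. For $\pi\in\Delta^{\mathcal A}$ and a distribution $\mu$ on the pairs $(S,\hat a_S)$, $S\in\mathcal S$, $\hat a_S\in\mathcal A_S$ (we write $\mu\in\Delta^{\mathcal D}$), let $$F(\pi,\mu)=\sum_{S,\hat a_S}\frac{\mu(S,\hat a_S)}{|S|}\sum_{i\in S}\mathbb E_{a\sim\pi}\big[\mathcal U_i(\hat a_S,a_{-S})-\mathcal U_i(a)\big].$$ The coalition exploitability of $\pi$ is $\max_{S\in\mathcal S}\max_{\hat a_S}\frac1{|S|}\sum_{i\in S}\mathbb E_{a\sim\pi}[\mathcal U_i(\hat a_S,a_{-S})-\mathcal U_i(a)]=\max_\mu F(\pi,\mu)$; a MASE is a minimizer of it over $\Delta^{\mathcal A}$, and $\pi\in\Delta^{\mathcal A}$ is an $\epsilon$-MASE if its exploitability exceeds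 that of any MASE by at most $\epsilon$. Let $\mathcal N(i)$ be the set of players whose action can affect $\mathcal U_i$, and let $\mathcal G$ be the graph on $[N]$ in which distinct $j,k$ are adjacent iff $j,k\in\mathcal N(i)$ for some $i$. Let $\mathcal T$ be a tree decomposition of $\mathcal G$ with $|\mathcal T|$ bags and of width $\mathrm{tw}=\mathrm{tw}(\mathcal G)$, with any root, and with each player $i$ assigned to some bag containing $\mathcal N(i)$. **Dynamics.** Let $T\ge1$ and $\eta>0$. For each round $t$ let $n^{(t)}(B,a_B)$ and $m^{(t)}_S(B,a_B)$ ($B\in\mathcal T$, $a_B\in\mathcal A_B$, $S\in\mathcal S$) be independent exponential variables of rate $\eta$, independent over all indices and rounds. Put $\tilde n^{(t)}(a)=\sum_B n^{(t)}(B,a_B)$ and $\tilde m^{(t)}(S,\hat a_S)=\max_{a\in\mathcal A,\,a_S=\hat a_S}\sum_B m_S^{(t)}(B,a_B)$. For $t=1,\dots,T$ let $$\pi^{(t)}\in\arg\min_{\pi\in\Delta^{\mathcal A}}\sum_{\tau<t}F(\pi,\mu^{(\tau)})-\langle\tilde n^{(t)},\pi\rangle,\qquad \mu^{(t)}\in\arg\max_{\mu\in\Delta^{\mathcal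 D}}\sum_{\tau<t}F(\pi^{(\tau)},\mu)+\langle\tilde m^{(t)},\mu\rangle,$$ and $\bar\pi=\frac1T\sum_{t=1}^T\pi^{(t)}$. **Theorem.** There is a universal constant $C>0$ such that the following holds. 1. Let $(\pi^*,\mu^*)$ be a solution of $\min_{\pi}\max_{\mu}F(\pi,\mu)$. For every $\delta>0$, with probability at least $1-\delta$, $$\max_{\hat\mu\in\Delta^{\mathcal D}}F(\bar\pi,\hat\mu)\le F(\pi^*,\mu^*)+4|\mathcal T|\frac{1+(\mathrm{tw}+1)\log A}{\eta T}+4\eta|\mathcal T|+2\sqrt{\frac{2\log(2/\delta)}{T}}$$ (for $\delta>2$, where the probability bound is trivial, the last root is read as $0$). 2. If $\eta=1/\sqrt T$, then for every $\delta>0$, with probability at least $1-\delta$, $\bar\pi$ is an $\epsilon$-MASE with $\epsilon=C\,\dfrac{|\mathcal T|(\mathrm{tw}+1)\log A+\sqrt{\log(2/\delta)}}{\sqrt T}$ (with the same convention for $\delta>2$). 3. For every realization of the noise, the algorithm that in each round computes $\pi^{(t)}$ by one dynamic program over $\mathcal T$ and $\mu^{(t)}$ by one dynamic program over $\mathcal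 T$ for each $S\in\mathcal S$ produces pure strategies $\pi^{(1)},\mu^{(1)},\dots,\pi^{(T)},\mu^{(T)}$ that follow the dynamics above, and takes at most $C\cdot T\,|\mathcal S|\,|\mathcal T|\,A^{\mathrm{tw}+1}$ elementary steps. An elementary step is an arithmetic operation or comparison of two reals, a memory access (a cell holds a real, a coalition, a joint action of one bag, or a reference to an array), the drawing of one noise variable, or the evaluation of the contribution $\frac1{|S|}\sum_{i\in S\text{ assigned to }B}(\mathcal U_i(\hat a_{S\cap B},a_{B\setminus S})-\mathcal U_i(a_B))$ of one bag to the gain of one coalition. The number of evaluations of individual utility functions in these contributions is at most $4\,T\,|\mathcal S|\,N\,A^{\mathrm{tw}+1}$. -/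

import Mathlib

open MeasureTheory ProbabilityTheory
open scoped BigOperators

noncomputable section

namespace MASE

/-! ### Games, correlated strategies and coalition deviations -/

/-- A finite game with player set `Fin N`, utilities in `[0,1]`, and a nonempty family of
nonempty coalitions. -/
structure Game (N : ℕ) where
  Act : Fin N → Type
  fintypeAct : ∀ i, Fintype (Act i)
  decEqAct : ∀ i, DecidableEq (Act i)
  nonemptyAct : ∀ i, Nonempty (Act i)
  utility : Fin N → (∀ i, Act i) → ℝ
  utility_mem : ∀ i a, utility i a ∈ Set.Icc (0 : ℝ) 1
  coalitions : Finset (Finset (Fin N))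
  coalitions_nonempty : coalitions.Nonempty
  coalition_nonempty : ∀ S ∈ coalitions, S.Nonempty

attribute [instance] Game.fintypeAct Game.decEqAct Game.nonemptyAct

namespace Game

variable {N : ℕ} (G : Game N)

/-- Joint actions of all players. -/
abbrev Profile : Type := ∀ i, G.Act i

/-- Joint actions of the players in `C`. -/
abbrev Local (C : Finset (Fin N)) : Type := ∀ i : C, G.Act i

/-- The type of coalitions of the game. -/
abbrev Coalition : Type := {S : Finset (Fin N) // S ∈ G.coalitions}

/-- A coalition deviation: a coalition together with a joint action of its members. -/
abbrev Deviation : Type := Σ S : G.Coalition, G.Local S.1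

instance : Nonempty G.Coalition := G.coalitions_nonempty.to_subtype

/-- The largest number of actions of a player. -/
def maxActions : ℕ := Finset.univ.sup fun i => Fintype.card (G.Act i)

variable {G}

/-- The profile in which the players in `C` play `b` and the others play as in `a`. -/
def override {C : Finset (Fin N)} (b : G.Local C) (a : G.Profile) : G.Profile :=
  fun i => if h : i ∈ C then b ⟨i, h⟩ else a i

/-- Restriction of a profile to the players in `C`. -/
def restrict (C : Finset (Fin N)) (a : G.Profile) : G.Local C := fun i => a i

/-- Extension of a partial joint action by fixed arbitrary actions. -/
def extend {C : Finset (Fin N)} (b : G.Local C) : G.Profile :=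
  override b fun _ => Classical.arbitrary _

/-- Restriction of a joint action of `C` to the players in `C₂` (used when `C₂ ⊆ C`). -/
def proj {C : Finset (Fin N)} (C₂ : Finset (Fin N)) (b : G.Local C) : G.Local C₂ :=
  restrict C₂ (extend b)

/-- The expected average gain of the coalition `d.1` when it deviates to `d.2` from `p`. -/
def avgGain (p : G.Profile → ℝ) (d : G.Deviation) : ℝ :=
  (1 / (d.1.1.card : ℝ)) * ∑ i ∈ d.1.1,
    ∑ a : G.Profile, p a * (G.utility i (override d.2 a) - G.utility i a)

/-- The payoff of the meta-game between correlator and deviator. -/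
def payoff (p : G.Profile → ℝ) (m : G.Deviation → ℝ) : ℝ :=
  ∑ d : G.Deviation, m d * avgGain p d

/-- Coalition exploitability: the maximum over all coalition deviations of the average gain
(a supremum over a finite nonempty type). -/
def exploitability (p : G.Profile → ℝ) : ℝ := ⨆ d : G.Deviation, avgGain p d

/-- Minimum average-strong equilibrium, over all correlated strategies. -/
def IsMASE (p : G.Profile → ℝ) : Prop :=
  p ∈ stdSimplex ℝ G.Profile ∧ ∀ q ∈ stdSimplex ℝ G.Profile, exploitability p ≤ exploitability q

/-- `ε`-approximate minimum average-strong equilibrium. -/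
def IsApproxMASE (ε : ℝ) (p : G.Profile → ℝ) : Prop :=
  p ∈ stdSimplex ℝ G.Profile ∧ ∀ q : G.Profile → ℝ, IsMASE q → exploitability p ≤ exploitability q + ε

/-- `(p, m)` solves `min_p max_m payoff p m` over the two simplices: `m` attains the maximum
for `p`, and no other correlated strategy has a smaller maximum. -/
def IsMinMaxSolution (p : G.Profile → ℝ) (m : G.Deviation → ℝ) : Prop :=
  p ∈ stdSimplex ℝ G.Profile ∧ m ∈ stdSimplex ℝ G.Deviation ∧
  (∀ m₂ ∈ stdSimplex ℝ G.Deviation, payoff p m₂ ≤ payoff p m) ∧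
  (∀ p₂ ∈ stdSimplex ℝ G.Profile, ∃ m₂ ∈ stdSimplex ℝ G.Deviation, payoff p m ≤ payoff p₂ m₂)

variable (G)

/-- `G.relevant i` is the set of players whose action can affect the utility of `i`. -/
def relevant (i : Fin N) : Set (Fin N) :=
  {j | ∃ (a : G.Profile) (x y : G.Act j),
    G.utility i (Function.update a j x) ≠ G.utility i (Function.update a j y)}

/-- The utility dependency graph: two distinct players are adjacent when both are relevant to
some player. -/
def depGraph : SimpleGraph (Fin N) where
  Adj i j := i ≠ j ∧ ∃ k, i ∈ G.relevant k ∧ j ∈ G.relevant k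
  symm := ⟨fun _ _ h => ⟨h.1.symm, h.2.imp fun _ hk => ⟨hk.2, hk.1⟩⟩⟩
  loopless := ⟨fun _ h => h.1 rfl⟩

end Game

/-! ### Tree decompositions -/

/-- A tree decomposition of a graph on `Fin N`, with `K` bags indexed by the nodes of a tree. -/
structure TreeDecomposition {N : ℕ} (H : SimpleGraph (Fin N)) where
  K : ℕ
  tree : SimpleGraph (Fin K)
  isTree : tree.IsTree
  bag : Fin K → Finset (Fin N)
  cover : ∀ i, ∃ B, i ∈ bag B
  edge : ∀ i j, H.Adj i j → ∃ B, i ∈ bag B ∧ j ∈ bag B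
  path : ∀ (i : Fin N) (u v : Fin K) (p : tree.Walk u v), p.IsPath →
    i ∈ bag u → i ∈ bag v → ∀ w ∈ p.support, i ∈ bag w

/-- The maximum bag size minus one. -/
def TreeDecomposition.width {N : ℕ} {H : SimpleGraph (Fin N)} (D : TreeDecomposition H) : ℕ :=
  (Finset.univ.sup fun B => (D.bag B).card) - 1

/-- The minimum width of a tree decomposition. -/
def treewidth {N : ℕ} (H : SimpleGraph (Fin N)) : ℕ :=
  sInf {w | ∃ D : TreeDecomposition H, D.width = w}

/-- A tree decomposition of the dependency graph with a root, in which each player `i` is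
assigned to a bag that contains all players relevant to `i`. -/
structure RootedDecomposition {N : ℕ} (G : Game N) extends TreeDecomposition G.depGraph where
  root : Fin K
  assign : Fin N → Fin K
  assign_spec : ∀ i, ∀ j ∈ G.relevant i, j ∈ bag (assign i)

namespace RootedDecomposition

variable {N : ℕ} {G : Game N} (D : RootedDecomposition G)

/-- Joint actions of the players in the bag `B`. -/
abbrev BagAct (B : Fin D.K) : Type := G.Local (D.bag B)

/-- Distance of a bag from the root. -/
def depth (B : Fin D.K) : ℕ := D.tree.dist D.root B

open Classical in
/-- The children of a bag. -/
def children (B : Fin D.K) : Finset (Fin D.K) :=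
  Finset.univ.filter fun B₂ => D.tree.Adj B B₂ ∧ D.depth B₂ = D.depth B + 1

open Classical in
/-- The father of a bag (the root itself for the root). -/
def parent (B : Fin D.K) : Fin D.K :=
  if h : ∃ P, B ∈ D.children P then h.choose else B

/-- The players shared by a bag and its father (none for the root). -/
def sep (B : Fin D.K) : Finset (Fin N) :=
  if B = D.root then ∅ else D.bag B ∩ D.bag (D.parent B)

/-! ### Perturbations and the follow-the-perturbed-leader dynamics -/

/-- The indices of the individual noise variables: one for each round, bag and joint action of
the bag for the correlator, and one for each round, coalition, bag and joint action of the bag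
for the deviator. -/
inductive NoiseIndex
  | corr (t : ℕ) (B : Fin D.K) (a : D.BagAct B)
  | dev (t : ℕ) (S : G.Coalition) (B : Fin D.K) (a : D.BagAct B)

/-- The perturbation of the joint action `a` of the correlator in round `t`: the sum of the
noise over the bags. -/
def corrNoise (ξ : D.NoiseIndex → ℝ) (t : ℕ) (a : G.Profile) : ℝ :=
  ∑ B, ξ (.corr t B (Game.restrict (D.bag B) a))

/-- The perturbation of the deviation `d` in round `t`. The dynamic program of the deviator
ranges, for each coalition, over all actions of the bags; hence the perturbation of a joint
action of the coalition is the maximum, over all its extensions to a full profile, of the sum of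
the noise over the bags (a supremum over a finite nonempty type). -/
def devNoise (ξ : D.NoiseIndex → ℝ) (t : ℕ) (d : G.Deviation) : ℝ :=
  ⨆ a : G.Profile, ∑ B, ξ (.dev t d.1 B (Game.restrict (D.bag B) (Game.override d.2 a)))

/-- The sequences `p 0, …, p (T-1)` and `m 0, …, m (T-1)` follow the perturbed leader: in each
round the correlator minimizes its perturbed cumulative payoff against the past deviations,
and the deviator maximizes its own against the past correlated strategies. In the first round
only the perturbation counts. -/
def FollowsFTPL (ξ : D.NoiseIndex → ℝ) (T : ℕ)
    (p : ℕ → G.Profile → ℝ) (m : ℕ → G.Deviation → ℝ) : Prop :=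
  ∀ t < T,
    (p t ∈ stdSimplex ℝ G.Profile ∧
      IsMinOn (fun q : G.Profile → ℝ => (∑ s ∈ Finset.range t, Game.payoff q (m s))
        - ∑ a, D.corrNoise ξ t a * q a) (stdSimplex ℝ G.Profile) (p t)) ∧
    (m t ∈ stdSimplex ℝ G.Deviation ∧
      IsMaxOn (fun q : G.Deviation → ℝ => (∑ s ∈ Finset.range t, Game.payoff (p s) q)
        + ∑ d, D.devNoise ξ t d * q d) (stdSimplex ℝ G.Deviation) (m t))

end RootedDecomposition

/-- The average of the first `T` strategies. -/
def average {ι : Type} (T : ℕ) (p : ℕ → ι → ℝ) : ι → ℝ :=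
  fun a => (1 / (T : ℝ)) * ∑ t ∈ Finset.range T, p t a

/-- The pure strategy that puts all mass on `x`. -/
def pureStrategy {ι : Type} [DecidableEq ι] (x : ι) : ι → ℝ := fun y => if y = x then 1 else 0

/-! ### Step counting -/

/-- A computation with its result, its number of elementary steps, and the number of
evaluations of individual utility functions it makes. -/
structure Timed (α : Type) where
  val : α
  steps : ℕ
  evals : ℕ

namespace Timed

instance : Monad Timed where
  pure x := ⟨x, 0, 0⟩
  bind x f := ⟨(f x.val).val, x.steps + (f x.val).steps, x.evals + (f x.val).evals⟩

/-- One elementary step: an arithmetic operation on two reals, reading or writing a memory cell,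
or drawing a noise variable. A cell holds a real, a coalition, a joint action of one bag,
or a reference to an array of cells. -/
def op {α : Type} (x : α) : Timed α := ⟨x, 1, 0⟩

/-- The loop that runs `f k` for each index `k ∈ s` and stores the result in cell `k`; the other
cells keep the content `old`. One step per index for the store, besides the body. -/
def store {ι : Type} [DecidableEq ι] {β : ι → Type} (s : Finset ι) (old : ∀ k, β k)
    (f : ∀ k, Timed (β k)) : Timed (∀ k, β k) :=
  ⟨fun k => if k ∈ s then (f k).val else old k, ∑ k ∈ s, ((f k).steps + 1),
    ∑ k ∈ s, (f k).evals⟩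

/-- The loop that runs `f k` for all indices `k` and stores the result in cell `k`. -/
def tabulate {ι : Type} [Fintype ι] {β : ι → Type} (f : ∀ k, Timed (β k)) : Timed (∀ k, β k) :=
  ⟨fun k => (f k).val, ∑ k, ((f k).steps + 1), ∑ k, (f k).evals⟩

/-- The loop that adds up the values `f k`, `k ∈ s`: one addition per index, besides the body. -/
def sum {ι : Type} (s : Finset ι) (f : ι → Timed ℝ) : Timed ℝ :=
  ⟨∑ k ∈ s, (f k).val, ∑ k ∈ s, ((f k).steps + 1), ∑ k ∈ s, (f k).evals⟩

open Classical in
/-- The loop that finds a maximizer of the values `f k`, `k ∈ s`: one comparison per index,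
besides the body. Ties are broken arbitrarily. -/
def argmax {ι : Type} [Nonempty ι] (s : Finset ι) (f : ι → Timed ℝ) : Timed ι :=
  ⟨if h : s.Nonempty then (s.exists_max_image (fun k => (f k).val) h).choose
    else Classical.arbitrary ι, ∑ k ∈ s, ((f k).steps + 1), ∑ k ∈ s, (f k).evals⟩

end Timed

namespace RootedDecomposition

variable {N : ℕ} {G : Game N} (D : RootedDecomposition G)

/-! ### Dynamic programming on the tree -/

/-- The contribution of the bag `B` to the average gain of the coalition `S` that deviates
to `b` from `a`: the gains of the members of `S` assigned to `B`, divided by the size of `S`. -/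
def bagGain (S : G.Coalition) (B : Fin D.K) (b a : D.BagAct B) : ℝ :=
  (1 / (S.1.card : ℝ)) * ∑ i ∈ S.1.filter (fun i => D.assign i = B),
    (G.utility i (Game.override (Game.restrict S.1 (Game.extend b)) (Game.extend a))
      - G.utility i (Game.extend a))

/-- Evaluating the gain of a bag is one elementary step; it evaluates two utilities for each
member of the coalition assigned to the bag. -/
def queryGain (S : G.Coalition) (B : Fin D.K) (b a : D.BagAct B) : Timed ℝ :=
  ⟨D.bagGain S B b a, 1, 2 * (S.1.filter (fun i => D.assign i = B)).card⟩

/-- A real for each joint action of each bag. -/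
abbrev Table : Type := ∀ B, D.BagAct B → ℝ

/-- The memory of the bottom-up pass: for each bag the table `h` of optimal values of its
subtree, and the message to its father, which is `h` maximized over the players not shared
with the father. -/
abbrev UpState : Type := ∀ B, (D.BagAct B → ℝ) × (G.Local (D.sep B) → ℝ)

/-- `h B a = w B a + ∑_{B₂ child of B} max {h B₂ a₂ | a₂ agrees with a on the shared players}`,
followed by the computation of the message of `B`. -/
def processUp (w : D.Table) (st : D.UpState) (B : Fin D.K) :
    Timed ((D.BagAct B → ℝ) × (G.Local (D.sep B) → ℝ)) := do
  let h ← Timed.tabulate (β := fun _ => ℝ) fun a : D.BagAct B => do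
    let x ← Timed.op (w B a)
    let y ← Timed.sum (D.children B) fun B₂ => Timed.op ((st B₂).2 (Game.proj (D.sep B₂) a))
    Timed.op (x + y)
  let msg ← Timed.tabulate (β := fun _ => ℝ) fun s : G.Local (D.sep B) => do
    let a ← Timed.argmax (Finset.univ.filter fun a : D.BagAct B => Game.proj (D.sep B) a = s)
      fun a => Timed.op (h a)
    Timed.op (h a)
  pure (h, msg)

/-- The bottom-up pass over the deepest `j` of the levels `K-1, …, 0` of the tree. -/
def upPass (w : D.Table) : ℕ → Timed D.UpState
  | 0 => pure fun _ => (fun _ => 0, fun _ => 0)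
  | j + 1 => do
    let st ← upPass w j
    let _ ← Timed.op ()
    Timed.store (Finset.univ.filter fun B => D.depth B = D.K - 1 - j) st (D.processUp w st)

/-- The top-down pass over the levels `0, …, j-1`, which reconstructs an optimal action of each
bag from the choice of its father. -/
def downPass (st : D.UpState) : ℕ → Timed (∀ B, D.BagAct B)
  | 0 => pure fun _ => Classical.arbitrary _
  | j + 1 => do
    let x ← downPass st j
    let _ ← Timed.op ()
    Timed.store (Finset.univ.filter fun B => D.depth B = j) x fun B => do
      let y ← Timed.op (x (D.parent B))
      Timed.argmax
        (Finset.univ.filter fun b : D.BagAct B => Game.proj (D.sep B) b = Game.proj (D.sep B) y)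
        fun b => Timed.op ((st B).1 b)

/-- The dynamic program: it returns the maximum over all profiles `a` of `∑_B w B a_B`, and a
maximizer, given by its restrictions to the bags. -/
def treeDP (w : D.Table) : Timed (ℝ × (∀ B, D.BagAct B)) := do
  let st ← D.upPass w D.K
  let x ← D.downPass st D.K
  let v ← Timed.op ((st D.root).1 (x D.root))
  pure (v, x)

/-- The profile given by its restrictions to the bags. -/
def assemble (x : ∀ B, D.BagAct B) : G.Profile :=
  fun i => x (D.cover i).choose ⟨i, (D.cover i).choose_spec⟩

/-! ### The algorithm -/

/-- What is played in one round: the joint action of the correlator, the coalition chosen by the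
deviator, and a profile whose restriction to that coalition is the deviation. -/
structure Play where
  base : ∀ B, D.BagAct B
  coal : G.Coalition
  devi : ∀ B, D.BagAct B

/-- The joint action played by the correlator. -/
def Play.profile {D : RootedDecomposition G} (z : D.Play) : G.Profile := D.assemble z.base

/-- The deviation played by the deviator. -/
def Play.deviation {D : RootedDecomposition G} (z : D.Play) : G.Deviation :=
  ⟨z.coal, Game.restrict z.coal.1 (D.assemble z.devi)⟩

/-- The memory of the algorithm: the cumulative bag gains of the past deviations, as functions of
the action of the correlator; the cumulative bag gains of each coalition against the past actions
of the correlator, as functions of the deviation; and the record of the past plays. -/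
structure Memory where
  loss : D.Table
  gain : G.Coalition → D.Table
  hist : ℕ → D.Play

/-- Set all cumulative gains to zero. -/
def zeroMemory : Timed D.Memory := do
  let l ← Timed.tabulate fun B => Timed.tabulate (β := fun _ => ℝ) fun _ : D.BagAct B =>
    Timed.op 0
  let g ← Timed.tabulate (β := fun _ => D.Table) fun _ : G.Coalition =>
    Timed.tabulate fun B => Timed.tabulate (β := fun _ => ℝ) fun _ : D.BagAct B => Timed.op 0
  pure ⟨l, g, fun _ => ⟨fun _ => Classical.arbitrary _, Classical.arbitrary _,
    fun _ => Classical.arbitrary _⟩⟩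

/-- One round: both sides perturb their tables by fresh noise and solve the perturbed problem by
dynamic programming (the deviator once for each coalition); then the tables are updated. -/
def playRound (ξ : D.NoiseIndex → ℝ) (t : ℕ) (M : D.Memory) : Timed D.Memory := do
  let w ← Timed.tabulate fun B => Timed.tabulate (β := fun _ => ℝ) fun a : D.BagAct B => do
    let l ← Timed.op (M.loss B a)
    let n ← Timed.op (ξ (.corr t B a))
    Timed.op (n - l)
  let x ← D.treeDP w
  let r ← Timed.tabulate (β := fun _ => ℝ × (∀ B, D.BagAct B)) fun S : G.Coalition => do
    let w₂ ← Timed.tabulate fun B => Timed.tabulate (β := fun _ => ℝ) fun b : D.BagAct B => do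
      let g ← Timed.op (M.gain S B b)
      let n ← Timed.op (ξ (.dev t S B b))
      Timed.op (g + n)
    D.treeDP w₂
  let S₀ ← Timed.argmax Finset.univ fun S : G.Coalition => Timed.op (r S).1
  let y ← Timed.op (r S₀).2
  let loss₂ ← Timed.tabulate fun B => Timed.tabulate (β := fun _ => ℝ) fun a : D.BagAct B => do
    let l ← Timed.op (M.loss B a)
    let b ← Timed.op (y B)
    let q ← D.queryGain S₀ B b a
    Timed.op (l + q)
  let gain₂ ← Timed.tabulate (β := fun _ => D.Table) fun S : G.Coalition =>
    Timed.tabulate fun B => Timed.tabulate (β := fun _ => ℝ) fun b : D.BagAct B => do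
      let g ← Timed.op (M.gain S B b)
      let a ← Timed.op (x.2 B)
      let q ← D.queryGain S B b a
      Timed.op (g + q)
  let hist₂ ← Timed.op (Function.update M.hist t ⟨x.2, S₀, y⟩)
  pure ⟨loss₂, gain₂, hist₂⟩

/-- The first `T` rounds of the algorithm with noise `ξ`. -/
def run (ξ : D.NoiseIndex → ℝ) : ℕ → Timed D.Memory
  | 0 => D.zeroMemory
  | t + 1 => do
    let M ← run ξ t
    D.playRound ξ t M

/-- The correlated strategy of round `t` produced by a run of `T` rounds. -/
def outCorr (ξ : D.NoiseIndex → ℝ) (T t : ℕ) : G.Profile → ℝ :=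
  pureStrategy ((D.run ξ T).val.hist t).profile

/-- The deviator strategy of round `t` produced by a run of `T` rounds. -/
def outDev (ξ : D.NoiseIndex → ℝ) (T t : ℕ) : G.Deviation → ℝ :=
  pureStrategy ((D.run ξ T).val.hist t).deviation

end RootedDecomposition

end MASE

end

noncomputable section

namespace MASE

/-! ### Exponential noise -/

/-! Both players follow the perturbed leader in a zero-sum game, and average play of two no-regret
players is nearly optimal. Two points need care: the regret may not scale with the number of joint
actions, and the claim is about realized pure plays.

Stability: an expert collects one noise variable per bag (`perturb`), and its gain is a sum of bag
gains whose sizes add up to at most one (`devGain_toDeviation`, `sum_share`). Raising the noise on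
the expert's own options by a vector of total weight at most `2` therefore keeps it the leader after
one more round. By memorylessness this costs a factor `exp (-(2 * η))`, whatever the number of bags
(`exp_mul_leaderProb_le`). A potential argument then gives `leader_regret`, with a starting term of
order (log of the number of experts plus number of bags) over `η` (`leaderValue_zero_le`). The
experts of the deviator are pairs of a coalition and a full profile, which turns its maximum noise
into sum noise.

Realized play: ties have probability zero, so almost surely the dynamics is the pure play of unique
leaders. A fixed finite history then has as its probability a product of leader probabilities
(`measure_leadersUpTo`). Each regret is an expectation over the player's own noise against the
realized opponent; the difference of the two expectations, `surplus`, has conditional mean zero, and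
an Azuma bound over the finite tree of histories controls its sum (`sum_prod_le_of_tail`). Adding
the two regrets and comparing with a min-max solution gives `payoff_average_le`.

Algorithm: along the tree the total of a table telescopes into edge terms that are nonpositive for
every profile and zero for the reconstructed one (`sum_table_eq`, `treeDP_spec`). So the algorithm
plays leaders, and leaders follow the dynamics (`round_of_isLeader`). The time bound holds because
messages scan the fibres of a projection, hence each bag action once. -/

theorem expMeasure_eq_withDensity (η : ℝ) :
    expMeasure η = volume.withDensity (exponentialPDF η) := rfl

theorem measurable_exponentialPDF (η : ℝ) : Measurable (exponentialPDF η) :=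
  (measurable_exponentialPDFReal η).ennreal_ofReal

/-- Memorylessness of the exponential law. -/
theorem expMeasure_inter_Ici {η c : ℝ} (hc : 0 ≤ c) {s : Set ℝ}
    (hs : MeasurableSet s) :
    expMeasure η (s ∩ Set.Ici c) =
      ENNReal.ofReal (Real.exp (-(η * c))) * expMeasure η ((fun x => x + c) ⁻¹' s) := by
  have hs' : MeasurableSet ((fun x : ℝ => x + c) ⁻¹' s) := (measurable_add_const c) hs
  rw [expMeasure_eq_withDensity, withDensity_apply _ (hs.inter measurableSet_Ici),
    withDensity_apply _ hs', ← lintegral_indicator (hs.inter measurableSet_Ici),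
    ← lintegral_indicator hs', ← lintegral_add_right_eq_self _ c, ← lintegral_const_mul _
      ((measurable_exponentialPDF η).indicator hs')]
  refine lintegral_congr fun x => ?_
  by_cases hx : x + c ∈ s
  · by_cases hx0 : 0 ≤ x
    · rw [Set.indicator_of_mem (show x + c ∈ s ∩ Set.Ici c from ⟨hx, by simpa using hx0⟩),
        Set.indicator_of_mem (show x ∈ (fun x : ℝ => x + c) ⁻¹' s from hx),
        exponentialPDF_of_nonneg (by linarith), exponentialPDF_of_nonneg hx0,
        ← ENNReal.ofReal_mul (Real.exp_nonneg _)]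
      congr 1
      rw [mul_add, neg_add, Real.exp_add]
      ring
    · rw [Set.indicator_of_notMem (fun h => hx0 (by simpa using h.2)),
        Set.indicator_of_mem (show x ∈ (fun x : ℝ => x + c) ⁻¹' s from hx),
        exponentialPDF_of_neg (not_le.mp hx0), mul_zero]
  · rw [Set.indicator_of_notMem (fun h => hx h.1),
      Set.indicator_of_notMem (show x ∉ (fun x : ℝ => x + c) ⁻¹' s from hx), mul_zero]

theorem ae_nonneg_expMeasure (η : ℝ) : ∀ᵐ x ∂(expMeasure η), 0 ≤ x := by
  rw [expMeasure_eq_withDensity, ae_withDensity_iff (measurable_exponentialPDF η)]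
  refine Filter.Eventually.of_forall fun x hx => ?_
  by_contra h
  exact hx (exponentialPDF_of_neg (not_le.mp h))

/-- The exponent `3/4 * η` fixes all constants of the noise term: its inverse is `4 / (3 * η)` and
the moment is `1 / (1 - 3/4) = 4`. Three logarithms of sizes and two copies of `log 4 ≤ 3/2` then
add up to the factor `4` of the theorem. -/
theorem lintegral_exp_expMeasure {η : ℝ} (hη : 0 < η) :
    ∫⁻ x, ENNReal.ofReal (Real.exp (3 / 4 * η * x)) ∂(expMeasure η) = 4 := by
  rw [expMeasure_eq_withDensity, lintegral_withDensity_eq_lintegral_mul _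
    (measurable_exponentialPDF η) (by fun_prop)]
  have h : ∀ x, (exponentialPDF η * fun x => ENNReal.ofReal (Real.exp (3 / 4 * η * x))) x
      = 4 * exponentialPDF (η / 4) x := by
    intro x
    simp only [Pi.mul_apply]
    by_cases hx : 0 ≤ x
    · rw [exponentialPDF_of_nonneg hx, exponentialPDF_of_nonneg hx,
        ← ENNReal.ofReal_mul (by positivity), show (4 : ENNReal) = ENNReal.ofReal 4 by simp,
        ← ENNReal.ofReal_mul (by norm_num), mul_assoc, ← Real.exp_add]
      congr 1
      ring_nf
    · rw [exponentialPDF_of_neg (not_le.mp hx), exponentialPDF_of_neg (not_le.mp hx)]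
      simp
  simp_rw [h]
  rw [lintegral_const_mul _ (measurable_exponentialPDF _),
    lintegral_exponentialPDF_eq_one (by positivity), mul_one]

theorem integrable_exp_expMeasure {η : ℝ} (hη : 0 < η) :
    Integrable (fun x => Real.exp (3 / 4 * η * x)) (expMeasure η) := by
  refine ⟨by fun_prop, ?_⟩
  rw [hasFiniteIntegral_iff_ofReal (Filter.Eventually.of_forall fun _ => (Real.exp_pos _).le),
    lintegral_exp_expMeasure hη]
  simp

theorem integral_exp_expMeasure {η : ℝ} (hη : 0 < η) :
    ∫ x, Real.exp (3 / 4 * η * x) ∂(expMeasure η) = 4 := by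
  rw [integral_eq_lintegral_of_nonneg_ae
    (Filter.Eventually.of_forall fun _ => (Real.exp_pos _).le) (by fun_prop),
    lintegral_exp_expMeasure hη]
  simp

/-- The law of independent exponential variables of rate `η`. -/
def expNoise (ι : Type) [Fintype ι] (η : ℝ) : Measure (ι → ℝ) :=
  Measure.pi fun _ => expMeasure η

/-! ### Product exponential noise: shifts and absence of atoms. -/

section Noise

variable {ι : Type} [Fintype ι] {η : ℝ}

theorem isProbabilityMeasure_expNoise (hη : 0 < η) : IsProbabilityMeasure (expNoise ι η) := by
  have := isProbabilityMeasure_expMeasure hη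
  unfold expNoise
  infer_instance

theorem ae_nonneg_expNoise (hη : 0 < η) : ∀ᵐ n ∂(expNoise ι η), ∀ i, 0 ≤ n i := by
  have := isProbabilityMeasure_expMeasure hη
  rw [ae_all_iff]
  intro i
  exact Measure.tendsto_eval_ae_ae.eventually (ae_nonneg_expMeasure η)

/-- Shifting the noise by a nonnegative vector costs an exponential factor in its `ℓ¹` norm. -/
theorem expNoise_shift (hη : 0 < η) {c : ι → ℝ} (hc : ∀ i, 0 ≤ c i) {s : Set (ι → ℝ)}
    (hs : MeasurableSet s) :
    ENNReal.ofReal (Real.exp (-(η * ∑ i, c i))) * expNoise ι η ((fun n => n + c) ⁻¹' s)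
      ≤ expNoise ι η s := by
  have := isProbabilityMeasure_expMeasure hη
  have := isProbabilityMeasure_expNoise (ι := ι) hη
  have hm : Measurable fun n : ι → ℝ => n + c := measurable_add_const c
  -- Memorylessness in every coordinate: above the corner `c` the law is a rescaled translate of
  -- itself. Checking boxes suffices; dropping the restriction leaves the inequality.
  have key : (expNoise ι η).restrict (Set.univ.pi fun i => Set.Ici (c i)) =
      ENNReal.ofReal (Real.exp (-(η * ∑ i, c i))) • (expNoise ι η).map (fun n => n + c) := by
    unfold expNoise
    rw [Measure.restrict_pi_pi]
    refine Measure.pi_eq fun t ht => ?_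
    have hbox : (fun n : ι → ℝ => n + c) ⁻¹' (Set.univ.pi t) =
        Set.univ.pi fun i => (fun x => x + c i) ⁻¹' t i := by
      ext n
      simp
    rw [Measure.smul_apply, Measure.map_apply hm (MeasurableSet.univ_pi ht), hbox, Measure.pi_pi,
      Finset.mul_sum, ← Finset.sum_neg_distrib, Real.exp_sum,
      ENNReal.ofReal_prod_of_nonneg (fun _ _ => (Real.exp_pos _).le), smul_eq_mul,
      ← Finset.prod_mul_distrib]
    refine Finset.prod_congr rfl fun i _ => ?_
    rw [Measure.restrict_apply (ht i), expMeasure_inter_Ici (hc i) (ht i)]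
  have h := congrArg (fun μ => μ s) key
  simp only [Measure.smul_apply, Measure.map_apply hm hs, smul_eq_mul] at h
  rw [← h]
  exact Measure.restrict_apply_le _ _

/-- A measurable function that grows strictly along one coordinate has no atoms. -/
theorem expNoise_level_eq_zero [DecidableEq ι] (hη : 0 < η) {L : (ι → ℝ) → ℝ} (hL : Measurable L)
    (k : ι) (hk : ∀ n x, L (n + Pi.single k x) = L n + x) (c : ℝ) :
    expNoise ι η {n | L n = c} = 0 := by
  have := isProbabilityMeasure_expNoise (ι := ι) hη
  have hcount := Measure.countable_meas_level_set_pos (μ := expNoise ι η) hL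
  -- Only countably many levels carry mass, so some level `d` above `c` is null. Moving along
  -- coordinate `k` by `d - c` carries level `c` to level `d`, and the shift bound makes `c` null
  -- too.
  obtain ⟨d, hd, hd0⟩ : ∃ d, c < d ∧ expNoise ι η {n | L n = d} = 0 := by
    by_contra! h
    have hsub : Set.Ioi c ⊆ {t | 0 < expNoise ι η {n | L n = t}} :=
      fun d hd => pos_iff_ne_zero.mpr (h d hd)
    have h0 := (hcount.mono hsub).measure_zero volume
    simp at h0
  have hshift := expNoise_shift hη (c := Pi.single k (d - c))
    (fun i => by
      by_cases hi : i = k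
      · subst hi; simp [hd.le]
      · simp [hi]) (hL (measurableSet_singleton d))
  have hpre : (fun n : ι → ℝ => n + Pi.single k (d - c)) ⁻¹' (L ⁻¹' {d}) = {n | L n = c} := by
    ext n
    simp only [Set.mem_preimage, Set.mem_singleton_iff, Set.mem_ofPred_eq, hk]
    constructor <;> intro h <;> linarith
  rw [hpre] at hshift
  have h0 : expNoise ι η (L ⁻¹' {d}) = 0 := hd0
  rw [h0, nonpos_iff_eq_zero, mul_eq_zero] at hshift
  rcases hshift with h | h
  · exact absurd h (by simpa using Real.exp_pos _)
  · exact h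

end Noise

/-! ### Following the perturbed leader with one noise variable per bag and option -/

section Leader

variable {K : ℕ} {Opt : Fin K → Type} {E : Type}

/-- The perturbation of an expert that picks the option `φ e B` in the bag `B`. -/
def perturb (φ : E → ∀ B, Opt B) (n : (Σ B, Opt B) → ℝ) (e : E) : ℝ := ∑ B, n ⟨B, φ e B⟩

/-- The expert `e` maximizes the perturbed reward. -/
def IsLeader (φ : E → ∀ B, Opt B) (X : E → ℝ) (n : (Σ B, Opt B) → ℝ) (e : E) : Prop :=
  ∀ e', X e' + perturb φ n e' ≤ X e + perturb φ n e

/-- Differences of rewards are controlled by bags in which the experts differ, with total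
weight at most `2`. -/
def Regular (φ : E → ∀ B, Opt B) (x : E → ℝ) : Prop :=
  ∃ c : E → Fin K → ℝ, (∀ e B, 0 ≤ c e B) ∧ (∀ e, ∑ B, c e B ≤ 2) ∧
    ∀ e e' (s : Finset (Fin K)), (∀ B, φ e B ≠ φ e' B → B ∈ s) → x e' - x e ≤ ∑ B ∈ s, c e B

variable {φ : E → ∀ B, Opt B} {η : ℝ}

@[fun_prop]
theorem measurable_perturb (e : E) : Measurable fun n => perturb φ n e := by
  unfold perturb
  fun_prop

theorem exists_isLeader [Finite E] [Nonempty E] (X : E → ℝ) (n : (Σ B, Opt B) → ℝ) :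
    ∃ e, IsLeader φ X n e :=
  Finite.exists_max fun e => X e + perturb φ n e

theorem IsLeader.unique {X : E → ℝ} {n : (Σ B, Opt B) → ℝ}
    (hn : ∀ e e', e ≠ e' → X e + perturb φ n e ≠ X e' + perturb φ n e') {e e' : E}
    (h : IsLeader φ X n e) (h' : IsLeader φ X n e') : e = e' := by
  by_contra hne
  exact hn e e' hne (le_antisymm (h' e) (h e'))

theorem perturb_nonneg {n : (Σ B, Opt B) → ℝ} (hn : ∀ i, 0 ≤ n i) (e : E) : 0 ≤ perturb φ n e :=
  Finset.sum_nonneg fun _ _ => hn _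

theorem sup_eq_of_isLeader [Fintype E] [Nonempty E] {X : E → ℝ} {n : (Σ B, Opt B) → ℝ} {e : E}
    (he : IsLeader φ X n e) :
    Finset.univ.sup' Finset.univ_nonempty (fun e => X e + perturb φ n e) =
      X e + perturb φ n e :=
  le_antisymm (Finset.sup'_le _ _ fun e' _ => he e')
    (Finset.le_sup' (fun e => X e + perturb φ n e) (Finset.mem_univ e))

theorem measurableSet_isLeader [Finite E] (X : E → ℝ) (e : E) :
    MeasurableSet {n | IsLeader φ X n e} := by
  have : {n | IsLeader φ X n e} =
      ⋂ e', {n | X e' + perturb φ n e' ≤ X e + perturb φ n e} := by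
    ext n
    simp [IsLeader]
  rw [this]
  exact MeasurableSet.iInter fun e' => measurableSet_le (by fun_prop) (by fun_prop)

theorem sum_indicator_isLeader [Fintype E] {X : E → ℝ} (x : E → ℝ) {n : (Σ B, Opt B) → ℝ}
    (hn : ∀ e e', e ≠ e' → X e + perturb φ n e ≠ X e' + perturb φ n e') {e : E}
    (he : IsLeader φ X n e) :
    ∑ e', ({n | IsLeader φ X n e'} : Set _).indicator (fun _ => x e') n = x e := by
  rw [Finset.sum_eq_single e]
  · exact Set.indicator_of_mem (show n ∈ {n | IsLeader φ X n e} from he) _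
  · intro e' _ hne
    exact Set.indicator_of_notMem (fun h => hne (IsLeader.unique hn h he)) _
  · simp

/-! ### Leader probabilities and their stability. -/

variable [∀ B, Fintype (Opt B)]

/-- The probability that an expert is the perturbed leader. -/
def leaderProb (φ : E → ∀ B, Opt B) (η : ℝ) (X : E → ℝ) (e : E) : ℝ :=
  (expNoise (Σ B, Opt B) η).real {n | IsLeader φ X n e}

/-- Distinct experts almost surely have distinct perturbed rewards. -/
theorem ae_no_tie [Finite E] (hη : 0 < η) (hφ : Function.Injective φ) (X : E → ℝ) :
    ∀ᵐ n ∂(expNoise (Σ B, Opt B) η), ∀ e e', e ≠ e' →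
      X e + perturb φ n e ≠ X e' + perturb φ n e' := by
  classical
  simp_rw [ae_all_iff]
  intro e e' hne
  -- In a bag where the two experts differ, the noise variable of `e` enters only one of the two
  -- perturbations, so their difference has no atoms.
  obtain ⟨B, hB⟩ := Function.ne_iff.mp (hφ.ne hne)
  have h := expNoise_level_eq_zero hη (L := fun n => perturb φ n e - perturb φ n e')
    (by fun_prop) (⟨B, φ e B⟩ : Σ B, Opt B) (fun n x => by
      have h1 : perturb φ (n + Pi.single ⟨B, φ e B⟩ x) e = perturb φ n e + x := by
        simp only [perturb, Pi.add_apply, Finset.sum_add_distrib]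
        congr 1
        rw [Finset.sum_eq_single B]
        · simp
        · intro B' _ hB'
          rw [Pi.single_eq_of_ne]
          intro h
          exact hB' (congrArg Sigma.fst h)
        · simp
      have h2 : perturb φ (n + Pi.single ⟨B, φ e B⟩ x) e' = perturb φ n e' := by
        simp only [perturb, Pi.add_apply, Finset.sum_add_distrib]
        rw [add_eq_left]
        refine Finset.sum_eq_zero fun B' _ => ?_
        rw [Pi.single_eq_of_ne]
        intro h
        obtain rfl : B' = B := congrArg Sigma.fst h
        exact hB (by simpa using h.symm)
      simp only [h1, h2]
      ring) (X e' - X e)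
  rw [ae_iff]
  refine measure_mono_null ?_ h
  intro n hn
  simp only [ne_eq, Set.mem_ofPred_eq, not_not] at hn ⊢
  linarith

theorem leaderProb_nonneg (X : E → ℝ) (e : E) : 0 ≤ leaderProb φ η X e := measureReal_nonneg

/-- The expected reward of the leader, as an integral. -/
theorem sum_leaderProb_mul [Fintype E] (hη : 0 < η) (X x : E → ℝ) :
    ∑ e, leaderProb φ η X e * x e =
      ∫ n, ∑ e, ({n | IsLeader φ X n e} : Set _).indicator (fun _ => x e) n
        ∂(expNoise (Σ B, Opt B) η) := by
  have := isProbabilityMeasure_expNoise (ι := Σ B, Opt B) hη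
  rw [integral_finsetSum _ fun e _ =>
    (integrable_const (x e)).indicator (measurableSet_isLeader X e)]
  refine Finset.sum_congr rfl fun e _ => ?_
  rw [integral_indicator (measurableSet_isLeader X e), setIntegral_const, smul_eq_mul]
  rfl

theorem sum_leaderProb [Fintype E] [Nonempty E] (hη : 0 < η) (hφ : Function.Injective φ)
    (X : E → ℝ) : ∑ e, leaderProb φ η X e = 1 := by
  have := isProbabilityMeasure_expNoise (ι := Σ B, Opt B) hη
  have h := sum_leaderProb_mul (φ := φ) hη X fun _ => 1
  simp only [mul_one] at h
  rw [h]
  have h2 : (fun n => ∑ e, ({n | IsLeader φ X n e} : Set _).indicator (fun _ => (1 : ℝ)) n)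
      =ᵐ[expNoise (Σ B, Opt B) η] fun _ => 1 := by
    filter_upwards [ae_no_tie hη hφ X] with n hn
    obtain ⟨e, he⟩ := exists_isLeader (φ := φ) X n
    exact sum_indicator_isLeader (fun _ => 1) hn he
  rw [integral_congr_ae h2]
  simp

/-- The noise is raised by `c e B` on the option of `e` in each bag. A rival receives the bonus only
in bags where it agrees with `e`, so the lead of `e` grows by the weight of the bags where they
differ, which is what `Regular` allows the rival to gain from `x`. The total shift is at most `2`.
-/
theorem exp_mul_leaderProb_le [Finite E] (hη : 0 < η) {x : E → ℝ} (hx : Regular φ x)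
    (X : E → ℝ) (e : E) :
    Real.exp (-(2 * η)) * leaderProb φ η X e ≤ leaderProb φ η (X + x) e := by
  classical
  have := isProbabilityMeasure_expNoise (ι := Σ B, Opt B) hη
  obtain ⟨c, hc0, hc2, hcx⟩ := hx
  set d : (Σ B, Opt B) → ℝ := fun k => if k.2 = φ e k.1 then c e k.1 else 0 with hd
  have hd0 : ∀ k, 0 ≤ d k := fun k => by
    simp only [hd]
    split_ifs
    · exact hc0 _ _
    · exact le_rfl
  have hdsum : ∑ k, d k = ∑ B, c e B := by
    rw [Fintype.sum_sigma]
    refine Finset.sum_congr rfl fun B _ => ?_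
    simp [hd]
  have hpert : ∀ n e', perturb φ (n + d) e' =
      perturb φ n e' + ∑ B with φ e' B = φ e B, c e B := by
    intro n e'
    simp only [perturb, Pi.add_apply, Finset.sum_add_distrib, hd, Finset.sum_filter]
  have hsub : {n | IsLeader φ X n e} ⊆ (fun n => n + d) ⁻¹' {n | IsLeader φ (X + x) n e} := by
    intro n hn e'
    have h1 := hn e'
    have h2 := hcx e e' (Finset.univ.filter fun B => ¬ φ e' B = φ e B)
      (fun B hB => by simpa using fun h => hB h.symm)
    have h3 := Finset.sum_filter_add_sum_filter_not Finset.univ (fun B => φ e' B = φ e B) (c e)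
    simp only [hpert, Pi.add_apply, Finset.filter_true]
    linarith
  have h := expNoise_shift hη hd0 (measurableSet_isLeader (φ := φ) (X + x) e)
  have h' := (mul_le_mul_right (measure_mono hsub) _).trans h
  have h2 := ENNReal.toReal_mono (measure_ne_top _ _) h'
  rw [ENNReal.toReal_mul, ENNReal.toReal_ofReal (Real.exp_pos _).le] at h2
  refine le_trans (mul_le_mul_of_nonneg_right ?_ (leaderProb_nonneg X e)) h2
  rw [Real.exp_le_exp, hdsum]
  nlinarith [hc2 e]

/-- For `η < 1`, the first term of the power series of `log (1 + η) - log (1 - η)` is already `2 *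
η`, and the others are nonnegative. For `η ≥ 1` the left side is nonpositive. -/
theorem one_sub_mul_exp_le {η : ℝ} (h0 : 0 ≤ η) : (1 - η) ≤ (1 + η) * Real.exp (-(2 * η)) := by
  rcases le_or_gt 1 η with h1 | h1
  · have := Real.exp_pos (-(2 * η))
    nlinarith
  have h := Real.hasSum_log_sub_log_of_abs_lt_one (x := η) (by rw [abs_of_nonneg h0]; exact h1)
  have h2 : 2 * η ≤ Real.log (1 + η) - Real.log (1 - η) := by
    have := h.summable.sum_le_tsum {0} (fun k _ => by positivity)
    rw [h.tsum_eq] at this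
    simpa using this
  have h3 := Real.exp_le_exp.mpr h2
  rw [Real.exp_sub, Real.exp_log (by linarith), Real.exp_log (by linarith),
    le_div_iff₀ (by linarith)] at h3
  rw [Real.exp_neg, ← div_eq_mul_inv, le_div_iff₀ (Real.exp_pos _)]
  linarith

/-- One step of regular rewards in `[-1, 1]` changes the expected reward by at most `2 η`. -/
theorem sum_leaderProb_stable [Fintype E] [Nonempty E] (hη : 0 < η) (hφ : Function.Injective φ)
    {x : E → ℝ} (hx : Regular φ x) (hx' : Regular φ (-x)) (hx1 : ∀ e, |x e| ≤ 1) (X : E → ℝ) :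
    ∑ e, leaderProb φ η (X + x) e * x e ≤ ∑ e, leaderProb φ η X e * x e + 2 * η := by
  have key : ∀ e, leaderProb φ η (X + x) e * x e - leaderProb φ η X e * x e ≤
      η * (leaderProb φ η (X + x) e + leaderProb φ η X e) := by
    intro e
    have h1 := exp_mul_leaderProb_le hη hx X e
    have h2 := exp_mul_leaderProb_le hη hx' (X + x) e
    rw [add_neg_cancel_right] at h2
    have h3 := one_sub_mul_exp_le hη.le
    have hp := leaderProb_nonneg (φ := φ) (η := η) X e
    have hq := leaderProb_nonneg (φ := φ) (η := η) (X + x) e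
    set p := leaderProb φ η X e
    set q := leaderProb φ η (X + x) e
    -- This symmetric form of the two ratio bounds gives `|q - p| ≤ η * (q + p)`; the masses of `p`
    -- and `q` sum to `2`, whence the constant `2 * η`.
    have h4 : (1 - η) * p ≤ (1 + η) * q := by nlinarith
    have h5 : (1 - η) * q ≤ (1 + η) * p := by nlinarith
    have h6 : |q - p| ≤ η * (q + p) := by
      rw [abs_le]
      constructor <;> nlinarith
    calc q * x e - p * x e = (q - p) * x e := by ring
      _ ≤ |(q - p) * x e| := le_abs_self _
      _ = |q - p| * |x e| := abs_mul _ _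
      _ ≤ |q - p| * 1 := mul_le_mul_of_nonneg_left (hx1 e) (abs_nonneg _)
      _ ≤ _ := by linarith
  have hsum := Finset.sum_le_sum fun e (_ : e ∈ Finset.univ) => key e
  rw [Finset.sum_sub_distrib, ← Finset.mul_sum, Finset.sum_add_distrib, sum_leaderProb hη hφ,
    sum_leaderProb hη hφ] at hsum
  linarith

/-! ### The regret bound by a potential argument. -/

/-- The expected maximal perturbed reward. -/
def leaderValue [Fintype E] [Nonempty E] (φ : E → ∀ B, Opt B) (η : ℝ) (X : E → ℝ) : ℝ :=
  ∫ n, Finset.univ.sup' Finset.univ_nonempty (fun e => X e + perturb φ n e)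
    ∂(expNoise (Σ B, Opt B) η)

theorem integrable_eval_expNoise {ι : Type} [Fintype ι] (hη : 0 < η) (i : ι) :
    Integrable (fun n : ι → ℝ => n i) (expNoise ι η) := by
  have := isProbabilityMeasure_expMeasure hη
  have h : Integrable (fun x : ℝ => x) (expMeasure η) := by
    refine ((integrable_exp_expMeasure hη).const_mul (4 / (3 * η))).mono' (by fun_prop) ?_
    filter_upwards [ae_nonneg_expMeasure η] with x hx
    rw [Real.norm_of_nonneg hx]
    have h1 := Real.add_one_le_exp (3 / 4 * η * x)
    calc x = 4 / (3 * η) * (3 / 4 * η * x) := by field_simp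
      _ ≤ _ := mul_le_mul_of_nonneg_left (by linarith) (by positivity)
  exact integrable_comp_eval (μ := fun _ : ι => expMeasure η) (i := i) (f := fun x : ℝ => x) h

theorem integrable_sup_perturb [Fintype E] [Nonempty E] (hη : 0 < η) (X : E → ℝ) :
    Integrable (fun n => Finset.univ.sup' Finset.univ_nonempty (fun e => X e + perturb φ n e))
      (expNoise (Σ B, Opt B) η) := by
  have := isProbabilityMeasure_expNoise (ι := Σ B, Opt B) hη
  have hint : ∀ e, Integrable (fun n => X e + perturb φ n e) (expNoise (Σ B, Opt B) η) :=
    fun e => (integrable_const _).add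
      (integrable_finsetSum _ fun B _ => integrable_eval_expNoise hη _)
  have hmeas : Measurable fun n : (Σ B, Opt B) → ℝ =>
      Finset.univ.sup' Finset.univ_nonempty (fun e => X e + perturb φ n e) := by
    have := Finset.measurable_sup' (s := (Finset.univ : Finset E)) Finset.univ_nonempty
      (f := fun e n => X e + perturb φ n e) (fun e _ => by fun_prop)
    convert this using 1
    ext n
    rw [Finset.sup'_apply]
  refine (integrable_finsetSum Finset.univ fun e _ => (hint e).norm).mono'
    hmeas.aestronglyMeasurable (Filter.Eventually.of_forall fun n => ?_)
  obtain ⟨e, _, he⟩ := Finset.exists_mem_eq_sup' (Finset.univ_nonempty (α := E))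
    fun e => X e + perturb φ n e
  rw [he]
  exact Finset.single_le_sum (f := fun e => ‖X e + perturb φ n e‖) (fun _ _ => norm_nonneg _)
    (Finset.mem_univ e)

/-- Be the leader: the leader for `X + x`, evaluated with `X`, is at most the maximum for `X`. So
the potential grows by no more than the expected reward of a player that already sees `x`. -/
theorem leaderValue_add_le [Fintype E] [Nonempty E] (hη : 0 < η) (hφ : Function.Injective φ)
    (X x : E → ℝ) :
    leaderValue φ η (X + x) ≤ leaderValue φ η X + ∑ e, leaderProb φ η (X + x) e * x e := by
  have := isProbabilityMeasure_expNoise (ι := Σ B, Opt B) hη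
  have hint : Integrable (fun n => ∑ e, ({n | IsLeader φ (X + x) n e} : Set _).indicator
      (fun _ => x e) n) (expNoise (Σ B, Opt B) η) :=
    integrable_finsetSum _ fun e _ =>
      (integrable_const (x e)).indicator (measurableSet_isLeader (X + x) e)
  rw [sum_leaderProb_mul hη, leaderValue, leaderValue,
    ← integral_add (integrable_sup_perturb hη X) hint]
  refine integral_mono_ae (integrable_sup_perturb hη (X + x))
    ((integrable_sup_perturb hη X).add hint) ?_
  filter_upwards [ae_no_tie hη hφ (X + x)] with n hn
  obtain ⟨e, he⟩ := exists_isLeader (φ := φ) (X + x) n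
  rw [sup_eq_of_isLeader he]
  simp only [Pi.add_apply]
  rw [sum_indicator_isLeader x hn he]
  have := Finset.le_sup' (fun e => X e + perturb φ n e) (Finset.mem_univ e)
  linarith

theorem le_leaderValue [Fintype E] [Nonempty E] (hη : 0 < η) (X : E → ℝ) (e : E) :
    X e ≤ leaderValue φ η X := by
  have := isProbabilityMeasure_expNoise (ι := Σ B, Opt B) hη
  have h : ∫ _, X e ∂(expNoise (Σ B, Opt B) η) ≤ leaderValue φ η X := by
    refine integral_mono_ae (integrable_const _) (integrable_sup_perturb hη X) ?_
    filter_upwards [ae_nonneg_expNoise hη] with n hn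
    have h1 := Finset.le_sup' (fun e => X e + perturb φ n e) (Finset.mem_univ e)
    have h2 := perturb_nonneg (φ := φ) hn e
    linarith
  simpa using h

/-- An expert uses exactly one noise variable in each of the `K` bags, so the moment factors into
`K` factors `4`. -/
theorem integral_exp_perturb (hη : 0 < η) (e : E) :
    Integrable (fun n => Real.exp (3 / 4 * η * perturb φ n e)) (expNoise (Σ B, Opt B) η) ∧
    ∫ n, Real.exp (3 / 4 * η * perturb φ n e) ∂(expNoise (Σ B, Opt B) η) = 4 ^ K := by
  classical
  have := isProbabilityMeasure_expMeasure hη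
  set f : (Σ B, Opt B) → ℝ → ℝ := fun i x =>
    if i.2 = φ e i.1 then Real.exp (3 / 4 * η * x) else 1 with hf
  have hint : ∀ i, Integrable (f i) (expMeasure η) := by
    intro i
    by_cases hi : i.2 = φ e i.1
    · simp only [hf, hi, if_true]
      exact integrable_exp_expMeasure hη
    · simp only [hf, hi, if_false]
      exact integrable_const 1
  have heq : (fun n : (Σ B, Opt B) → ℝ => Real.exp (3 / 4 * η * perturb φ n e)) =
      fun n => ∏ i, f i (n i) := by
    ext n
    rw [Fintype.prod_sigma, perturb, Finset.mul_sum, Real.exp_sum]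
    refine Finset.prod_congr rfl fun B _ => ?_
    simp [hf]
  rw [heq]
  refine ⟨Integrable.fintype_prod hint, ?_⟩
  unfold expNoise
  rw [integral_fintype_prod_eq_prod, Fintype.prod_sigma]
  have h4 : ∀ B : Fin K, ∏ o : Opt B, ∫ x, f ⟨B, o⟩ x ∂(expMeasure η) = 4 := by
    intro B
    rw [Finset.prod_eq_single (φ e B)]
    · simp only [hf, if_true]
      exact integral_exp_expMeasure hη
    · intro o _ ho
      simp [hf, ho]
    · simp
  simp [h4]

/-- The expected maximal noise. -/
theorem leaderValue_zero_le [Fintype E] [Nonempty E] (hη : 0 < η) :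
    leaderValue φ η (0 : E → ℝ) ≤
      4 / (3 * η) * (Real.log (Fintype.card E) + K * Real.log 4) := by
  have := isProbabilityMeasure_expNoise (ι := Σ B, Opt B) hη
  set M : ℝ := Fintype.card E * 4 ^ K with hM
  have hcard : (0 : ℝ) < Fintype.card E := by exact_mod_cast Fintype.card_pos
  have hMpos : 0 < M := by positivity
  have hint : Integrable (fun n => ∑ e, Real.exp (3 / 4 * η * perturb φ n e))
      (expNoise (Σ B, Opt B) η) :=
    integrable_finsetSum _ fun e _ => (integral_exp_perturb hη e).1
  have hval : ∫ n, ∑ e : E, Real.exp (3 / 4 * η * perturb φ n e)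
      ∂(expNoise (Σ B, Opt B) η) = M := by
    rw [integral_finsetSum _ fun e _ => (integral_exp_perturb hη e).1]
    simp [(integral_exp_perturb hη _).2, hM]
  have hlog : Real.log M = Real.log (Fintype.card E) + K * Real.log 4 := by
    rw [hM, Real.log_mul hcard.ne' (by positivity), Real.log_pow]
  have hle : leaderValue φ η (0 : E → ℝ) ≤ ∫ n, 4 / (3 * η) * (Real.log M - 1 +
      (∑ e, Real.exp (3 / 4 * η * perturb φ n e)) / M) ∂(expNoise (Σ B, Opt B) η) := by
    refine integral_mono_ae (integrable_sup_perturb hη 0)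
      (((integrable_const _).add (hint.div_const M)).const_mul _)
      (Filter.Eventually.of_forall fun n => Finset.sup'_le _ _ fun e _ => ?_)
    -- The tangent of the exponential at `Real.log M` replaces Jensen. With `M` the expectation of
    -- the sum of exponentials, the bound integrates exactly to `Real.log M`.
    have h1 := Real.add_one_le_exp (3 / 4 * η * perturb φ n e - Real.log M)
    rw [Real.exp_sub, Real.exp_log hMpos] at h1
    have h2 : Real.exp (3 / 4 * η * perturb φ n e) ≤ ∑ e, Real.exp (3 / 4 * η * perturb φ n e) :=
      Finset.single_le_sum (f := fun e => Real.exp (3 / 4 * η * perturb φ n e))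
        (fun _ _ => (Real.exp_pos _).le) (Finset.mem_univ e)
    have h3 := div_le_div_of_nonneg_right h2 hMpos.le
    calc (0 : E → ℝ) e + perturb φ n e = 4 / (3 * η) * (3 / 4 * η * perturb φ n e) := by
          simp only [Pi.zero_apply]
          field_simp
          ring
      _ ≤ _ := mul_le_mul_of_nonneg_left (by linarith) (by positivity)
  refine hle.trans_eq ?_
  rw [integral_const_mul, integral_add (integrable_const _) (hint.div_const M), integral_div, hval,
    div_self hMpos.ne', ← hlog]
  simp

/-- The regret of following the perturbed leader, against any sequence of regular rewards. -/
theorem leader_regret [Fintype E] [Nonempty E] (hη : 0 < η) (hφ : Function.Injective φ)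
    (x : ℕ → E → ℝ) (hx : ∀ t, Regular φ (x t)) (hx' : ∀ t, Regular φ (-(x t)))
    (hx1 : ∀ t e, |x t e| ≤ 1) (T : ℕ) (e : E) :
    ∑ t ∈ Finset.range T, x t e ≤
      ∑ t ∈ Finset.range T, ∑ e', leaderProb φ η (∑ s ∈ Finset.range t, x s) e' * x t e' +
        4 / (3 * η) * (Real.log (Fintype.card E) + K * Real.log 4) + 2 * η * T := by
  -- The induction runs on the potential. Each round it grows by the reward of the leader that sees
  -- the new reward, and stability exchanges it for the actual leader at cost `2 * η`.
  have key : ∀ T : ℕ, leaderValue φ η (∑ s ∈ Finset.range T, x s) ≤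
      ∑ t ∈ Finset.range T, ∑ e', leaderProb φ η (∑ s ∈ Finset.range t, x s) e' * x t e' +
        4 / (3 * η) * (Real.log (Fintype.card E) + K * Real.log 4) + 2 * η * T := by
    intro T
    induction T with
    | zero => simpa using leaderValue_zero_le (φ := φ) hη
    | succ T ih =>
      have h1 := leaderValue_add_le hη hφ (∑ s ∈ Finset.range T, x s) (x T)
      have h2 := sum_leaderProb_stable hη hφ (hx T) (hx' T) (hx1 T) (∑ s ∈ Finset.range T, x s)
      rw [Finset.sum_range_succ, Finset.sum_range_succ]
      push_cast
      linarith
  have h := le_leaderValue (φ := φ) hη (∑ s ∈ Finset.range T, x s) e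
  rw [Finset.sum_apply] at h
  exact h.trans (key T)

end Leader

/-! ### Linear optimization over the simplex -/

section Simplex

variable {ι : Type} [Fintype ι]

theorem sum_mul_le_of_mem_stdSimplex {q : ι → ℝ} (hq : q ∈ stdSimplex ℝ ι) {v : ι → ℝ} {c : ℝ}
    (hv : ∀ j, v j ≤ c) : ∑ j, q j * v j ≤ c := by
  calc ∑ j, q j * v j ≤ ∑ j, q j * c :=
        Finset.sum_le_sum fun j _ => mul_le_mul_of_nonneg_left (hv j) (hq.1 j)
    _ = c := by rw [← Finset.sum_mul, hq.2, one_mul]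

variable [DecidableEq ι]

theorem pureStrategy_mem_stdSimplex (i : ι) : pureStrategy i ∈ stdSimplex ℝ ι := by
  refine ⟨fun j => ?_, by simp [pureStrategy]⟩
  unfold pureStrategy
  split_ifs <;> norm_num

theorem sum_pureStrategy_mul (i : ι) (v : ι → ℝ) : ∑ j, pureStrategy i j * v j = v i := by
  simp [pureStrategy]

theorem eq_pureStrategy_of_maximal {q : ι → ℝ} (hq : q ∈ stdSimplex ℝ ι) {v : ι → ℝ} {i : ι}
    (hmax : v i ≤ ∑ j, q j * v j) (hi : ∀ j, j ≠ i → v j < v i) : q = pureStrategy i := by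
  have h0 : ∀ j, j ≠ i → q j = 0 := by
    have hsum : ∑ j, q j * (v i - v j) ≤ 0 := by
      simp only [mul_sub, Finset.sum_sub_distrib, ← Finset.sum_mul, hq.2]
      linarith
    have hnn : ∀ j ∈ Finset.univ, 0 ≤ q j * (v i - v j) := fun j _ => by
      rcases eq_or_ne j i with rfl | h
      · simp
      · exact mul_nonneg (hq.1 j) (by linarith [hi j h])
    intro j hj
    have := (Finset.sum_eq_zero_iff_of_nonneg hnn).mp
      (le_antisymm hsum (Finset.sum_nonneg hnn)) j (Finset.mem_univ j)
    rcases mul_eq_zero.mp this with h | h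
    · exact h
    · linarith [hi j hj]
  ext j
  by_cases hj : j = i
  · subst hj
    have := hq.2
    rw [Finset.sum_eq_single j (fun k _ hk => h0 k hk) (by simp)] at this
    simp [pureStrategy, this]
  · simp [pureStrategy, hj, h0 j hj]

end Simplex

/-! ### Gains and their decomposition along the bags -/

namespace Game

variable {N : ℕ} {G : Game N}

/-- The average gain of a coalition deviation from a profile. -/
def devGain (a : G.Profile) (d : G.Deviation) : ℝ :=
  (1 / (d.1.1.card : ℝ)) * ∑ i ∈ d.1.1, (G.utility i (override d.2 a) - G.utility i a)

theorem avgGain_eq (p : G.Profile → ℝ) (d : G.Deviation) :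
    avgGain p d = ∑ a, p a * devGain a d := by
  simp only [avgGain, devGain, Finset.mul_sum]
  rw [Finset.sum_comm]
  refine Finset.sum_congr rfl fun a _ => Finset.sum_congr rfl fun i _ => ?_
  ring

theorem avgGain_pureStrategy (a : G.Profile) (d : G.Deviation) :
    avgGain (pureStrategy a) d = devGain a d := by
  rw [avgGain_eq, sum_pureStrategy_mul]

theorem payoff_pureStrategy (p : G.Profile → ℝ) (d : G.Deviation) :
    payoff p (pureStrategy d) = avgGain p d := by
  rw [payoff, sum_pureStrategy_mul]

/-- The deviation of the members of a coalition to their actions in a profile. -/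
def toDeviation (e : G.Coalition × G.Profile) : G.Deviation := ⟨e.1, restrict e.1.1 e.2⟩

theorem override_restrict_self {C : Finset (Fin N)} (b : G.Local C) (a : G.Profile) :
    restrict C (override b a) = b := by
  ext i
  simp [restrict, override]

theorem toDeviation_override (d : G.Deviation) (a : G.Profile) :
    toDeviation (d.1, override d.2 a) = d := by
  simp only [toDeviation, override_restrict_self]

theorem utility_congr {i : Fin N} {a a' : G.Profile} (h : ∀ j ∈ G.relevant i, a j = a' j) :
    G.utility i a = G.utility i a' := by
  classical
  -- Coordinates are switched from `a` to `a'` one at a time: a relevant coordinate does not change,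
  -- an irrelevant one cannot matter.
  suffices H : ∀ s : Finset (Fin N), G.utility i (fun j => if j ∈ s then a' j else a j) =
      G.utility i a by
    simpa using (H Finset.univ).symm
  intro s
  induction s using Finset.induction_on with
  | empty => simp
  | insert k s hk ih =>
    rw [← ih]
    set b : G.Profile := fun j => if j ∈ s then a' j else a j with hb
    have h1 : (fun j => if j ∈ insert k s then a' j else a j) = Function.update b k (a' k) := by
      ext j
      by_cases hj : j = k
      · subst hj
        simp
      · simp [hb, hj]
    have h2 : Function.update b k (a k) = b := by
      rw [Function.update_eq_self_iff]
      simp [hb, hk]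
    rw [h1]
    by_cases hrel : k ∈ G.relevant i
    · rw [← h k hrel, h2]
    · by_contra hne
      exact hrel ⟨b, a' k, a k, by rwa [h2]⟩

theorem card_coalition_pos (S : G.Coalition) : (0 : ℝ) < S.1.card := by
  exact_mod_cast (G.coalition_nonempty S.1 S.2).card_pos

theorem card_act_le_maxActions (i : Fin N) : Fintype.card (G.Act i) ≤ G.maxActions :=
  Finset.le_sup (f := fun i => Fintype.card (G.Act i)) (Finset.mem_univ i)

end Game

namespace RootedDecomposition

open Game

variable {N : ℕ} {G : Game N} (D : RootedDecomposition G)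

/-- The fraction of the members of a coalition that are assigned to a bag. -/
def share (S : G.Coalition) (B : Fin D.K) : ℝ :=
  (1 / (S.1.card : ℝ)) * (S.1.filter fun i => D.assign i = B).card

theorem share_nonneg (S : G.Coalition) (B : Fin D.K) : 0 ≤ D.share S B := by
  unfold share
  positivity

theorem sum_share (S : G.Coalition) : ∑ B, D.share S B = 1 := by
  unfold share
  rw [← Finset.mul_sum, ← Nat.cast_sum,
    ← Finset.card_eq_sum_card_fiberwise (t := Finset.univ) (fun _ _ => by simp)]
  have := card_coalition_pos S
  field_simp

theorem abs_bagGain_le (S : G.Coalition) (B : Fin D.K) (b a : D.BagAct B) :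
    |D.bagGain S B b a| ≤ D.share S B := by
  unfold bagGain share
  rw [abs_mul, abs_of_nonneg (by positivity)]
  refine mul_le_mul_of_nonneg_left ((Finset.abs_sum_le_sum_abs _ _).trans ?_) (by positivity)
  rw [← nsmul_one, ← Finset.sum_const]
  refine Finset.sum_le_sum fun i _ => ?_
  obtain ⟨h1, h2⟩ := G.utility_mem i (override (restrict S.1 (Game.extend b)) (Game.extend a))
  obtain ⟨h3, h4⟩ := G.utility_mem i (Game.extend a)
  rw [abs_le]
  constructor <;> linarith

/-- The bag assigned to a player contains everyone relevant to its utility, so the arbitrary actions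
filled in outside the bag by `Game.extend` have no effect. -/
theorem devGain_toDeviation (a : G.Profile) (e : G.Coalition × G.Profile) :
    devGain a (toDeviation e) =
      ∑ B, D.bagGain e.1 B (restrict (D.bag B) e.2) (restrict (D.bag B) a) := by
  simp only [devGain, bagGain, toDeviation]
  rw [← Finset.mul_sum, ← Finset.sum_fiberwise e.1.1 D.assign]
  congr 1
  refine Finset.sum_congr rfl fun B _ => Finset.sum_congr rfl fun i hi => ?_
  obtain rfl := (Finset.mem_filter.mp hi).2
  congr 1 <;> refine utility_congr fun j hj => ?_
  · have := D.assign_spec i j hj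
    simp [override, restrict, Game.extend, this]
  · have := D.assign_spec i j hj
    simp [override, restrict, Game.extend, this]

theorem abs_devGain_toDeviation_le (D : RootedDecomposition G) (a : G.Profile)
    (e : G.Coalition × G.Profile) : |devGain a (toDeviation e)| ≤ 1 := by
  rw [D.devGain_toDeviation, ← D.sum_share e.1]
  exact (Finset.abs_sum_le_sum_abs _ _).trans
    (Finset.sum_le_sum fun B _ => D.abs_bagGain_le _ _ _ _)

/-- The options of a profile are its restrictions to the bags. -/
def corrOption (a : G.Profile) (B : Fin D.K) : D.BagAct B := restrict (D.bag B) a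

/-- The options of a deviator are the coalition together with the actions of the bags. -/
def devOption (e : G.Coalition × G.Profile) (B : Fin D.K) : G.Coalition × D.BagAct B :=
  (e.1, restrict (D.bag B) e.2)

theorem corrOption_injective : Function.Injective D.corrOption := by
  intro a a' h
  ext i
  obtain ⟨B, hB⟩ := D.cover i
  exact congrFun (congrFun h B) ⟨i, hB⟩

theorem devOption_injective : Function.Injective D.devOption := by
  rintro ⟨S, a⟩ ⟨S', a'⟩ h
  have h1 : S = S' := congrArg Prod.fst (congrFun h D.root)
  have h2 : a = a' := D.corrOption_injective (funext fun B => congrArg Prod.snd (congrFun h B))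
  rw [h1, h2]

/-- A criterion for rewards and their negatives to be regular. -/
theorem regular_of_abs_le {K : ℕ} {Opt : Fin K → Type} {E : Type} {φ : E → ∀ B, Opt B}
    {x : E → ℝ} (c : E → Fin K → ℝ) (h0 : ∀ e B, 0 ≤ c e B) (h2 : ∀ e, ∑ B, c e B ≤ 2)
    (h : ∀ e e' (s : Finset (Fin K)), (∀ B, φ e B ≠ φ e' B → B ∈ s) →
      |x e' - x e| ≤ ∑ B ∈ s, c e B) : Regular φ x ∧ Regular φ (-x) := by
  refine ⟨⟨c, h0, h2, fun e e' s hs => (le_abs_self _).trans (h e e' s hs)⟩,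
    ⟨c, h0, h2, fun e e' s hs => ?_⟩⟩
  have := neg_abs_le (x e' - x e)
  have := h e e' s hs
  simp only [Pi.neg_apply]
  linarith

theorem abs_sum_sub_sum_le {K : ℕ} {f g w : Fin K → ℝ} {s : Finset (Fin K)}
    (hs : ∀ B, B ∉ s → f B = g B) (hf : ∀ B, |f B| ≤ w B) (hg : ∀ B, |g B| ≤ w B) :
    |∑ B, f B - ∑ B, g B| ≤ ∑ B ∈ s, 2 * w B := by
  rw [← Finset.sum_sub_distrib,
    ← Finset.sum_subset (Finset.subset_univ s) (fun B _ hB => by rw [hs B hB, sub_self])]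
  refine (Finset.abs_sum_le_sum_abs _ _).trans (Finset.sum_le_sum fun B _ => ?_)
  exact (abs_sub _ _).trans (by linarith [hf B, hg B])

/-- A bag gain lies between minus and plus the share of the bag, so changing the bag moves it by at
most twice the share; the shares add up to one. -/
theorem regular_corr (e : G.Coalition × G.Profile) :
    Regular D.corrOption (fun a => devGain a (toDeviation e)) ∧
      Regular D.corrOption (-fun a => devGain a (toDeviation e)) := by
  refine regular_of_abs_le (fun _ B => 2 * D.share e.1 B)
    (fun _ B => mul_nonneg zero_le_two (D.share_nonneg _ _))
    (fun _ => by rw [← Finset.mul_sum, D.sum_share, mul_one]) fun a a' s hs => ?_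
  rw [D.devGain_toDeviation, D.devGain_toDeviation]
  refine abs_sum_sub_sum_le (fun B hB => ?_) (fun B => D.abs_bagGain_le _ _ _ _)
    (fun B => D.abs_bagGain_le _ _ _ _)
  have : D.corrOption a B = D.corrOption a' B := by
    by_contra h
    exact hB (hs B h)
  simp only [corrOption] at this
  rw [this]

/-- The coalition is part of every option, so experts with different coalitions differ in all bags
and the full weight `2` covers any two gains in `[-1, 1]`. With equal coalitions the argument is the
one for the correlator. -/
theorem regular_dev (a : G.Profile) :
    Regular D.devOption (fun e => devGain a (toDeviation e)) ∧
      Regular D.devOption (-fun e => devGain a (toDeviation e)) := by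
  refine regular_of_abs_le (fun e B => 2 * D.share e.1 B)
    (fun _ B => mul_nonneg zero_le_two (D.share_nonneg _ _))
    (fun _ => by rw [← Finset.mul_sum, D.sum_share, mul_one]) fun e e' s hs => ?_
  obtain ⟨S, b⟩ := e
  obtain ⟨S', b'⟩ := e'
  by_cases hS : S = S'
  · subst hS
    rw [D.devGain_toDeviation, D.devGain_toDeviation]
    refine abs_sum_sub_sum_le (fun B hB => ?_) (fun B => D.abs_bagGain_le _ _ _ _)
      (fun B => D.abs_bagGain_le _ _ _ _)
    have : D.devOption (S, b) B = D.devOption (S, b') B := by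
      by_contra h
      exact hB (hs B h)
    have := congrArg Prod.snd this
    simp only [devOption] at this
    rw [this]
  · have hsu : s = Finset.univ := by
      ext B
      simp only [Finset.mem_univ, iff_true]
      exact hs B fun h => hS (congrArg Prod.fst h)
    rw [hsu, ← Finset.mul_sum, D.sum_share, mul_one]
    have h1 := D.abs_devGain_toDeviation_le a (S, b)
    have h2 := D.abs_devGain_toDeviation_le a (S', b')
    exact (abs_sub _ _).trans (by linarith)

/-! ### Rounds of the dynamics, in terms of perturbed leaders -/

/-- The noise of the correlator in round `t`. -/
def corrBlock (ξ : D.NoiseIndex → ℝ) (t : ℕ) : (Σ B, D.BagAct B) → ℝ :=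
  fun k => ξ (.corr t k.1 k.2)

/-- The noise of the deviator in round `t`. -/
def devBlock (ξ : D.NoiseIndex → ℝ) (t : ℕ) : (Σ B, G.Coalition × D.BagAct B) → ℝ :=
  fun k => ξ (.dev t k.2.1 k.1 k.2.2)

theorem corrNoise_eq (ξ : D.NoiseIndex → ℝ) (t : ℕ) (a : G.Profile) :
    D.corrNoise ξ t a = perturb D.corrOption (D.corrBlock ξ t) a := rfl

/-- With `exists_devNoise_eq`, this lifts the problem of the deviator to pairs of a coalition and a
profile, where the noise is a sum over bags. The gain sees only the actions of the coalition, so the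
lift preserves the maximum. -/
theorem perturb_le_devNoise (ξ : D.NoiseIndex → ℝ) (t : ℕ) (e : G.Coalition × G.Profile) :
    perturb D.devOption (D.devBlock ξ t) e ≤ D.devNoise ξ t (toDeviation e) := by
  have h : override (toDeviation e).2 e.2 = e.2 := by
    ext i
    simp only [override, toDeviation, restrict]
    by_cases hi : i ∈ e.1.1
    · exact dif_pos hi
    · exact dif_neg hi
  have h2 := le_ciSup (f := fun a : G.Profile => ∑ B, ξ (.dev t (toDeviation e).1 B
    (restrict (D.bag B) (override (toDeviation e).2 a)))) (Set.finite_range _).bddAbove e.2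
  rw [h] at h2
  exact h2

theorem exists_devNoise_eq (ξ : D.NoiseIndex → ℝ) (t : ℕ) (d : G.Deviation) :
    ∃ e, toDeviation e = d ∧ D.devNoise ξ t d = perturb D.devOption (D.devBlock ξ t) e := by
  obtain ⟨a, ha⟩ := exists_eq_ciSup_of_finite (f := fun a : G.Profile => ∑ B, ξ (.dev t d.1 B
    (restrict (D.bag B) (override d.2 a))))
  exact ⟨(d.1, override d.2 a), toDeviation_override d a, ha.symm⟩

/-- A history of pure plays. -/
abbrev History (G : Game N) : Type := ℕ → G.Profile × (G.Coalition × G.Profile)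

/-- The cumulative reward of the correlator before round `t`. -/
def corrReward (h : History G) (t : ℕ) : G.Profile → ℝ :=
  ∑ s ∈ Finset.range t, -fun a => devGain a (toDeviation (h s).2)

/-- The cumulative reward of the deviator before round `t`. -/
def devReward (h : History G) (t : ℕ) : G.Coalition × G.Profile → ℝ :=
  ∑ s ∈ Finset.range t, fun e => devGain (h s).1 (toDeviation e)

/-- The strategies before round `t` are the pure strategies of the history. -/
def PlaysHistory (h : History G) (t : ℕ) (p : ℕ → G.Profile → ℝ) (m : ℕ → G.Deviation → ℝ) :
    Prop :=
  ∀ s < t, p s = pureStrategy (h s).1 ∧ m s = pureStrategy (toDeviation (h s).2)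

section Round

variable {h : History G} {t : ℕ} {p : ℕ → G.Profile → ℝ} {m : ℕ → G.Deviation → ℝ}

theorem corr_objective (ξ : D.NoiseIndex → ℝ) (hp : PlaysHistory h t p m) (q : G.Profile → ℝ) :
    (∑ s ∈ Finset.range t, payoff q (m s)) - ∑ a, D.corrNoise ξ t a * q a =
      -∑ a, q a * (corrReward h t a + perturb D.corrOption (D.corrBlock ξ t) a) := by
  have h1 : ∑ s ∈ Finset.range t, payoff q (m s) = -∑ a, q a * corrReward h t a := by
    simp only [corrReward, Finset.sum_apply, Pi.neg_apply, Finset.sum_neg_distrib, mul_neg,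
      neg_neg, Finset.mul_sum]
    rw [Finset.sum_comm]
    refine Finset.sum_congr rfl fun s hs => ?_
    rw [(hp s (Finset.mem_range.mp hs)).2, payoff_pureStrategy, avgGain_eq]
  rw [h1]
  simp only [mul_add, Finset.sum_add_distrib, corrNoise_eq]
  simp only [mul_comm]
  ring

theorem dev_objective (ξ : D.NoiseIndex → ℝ) (hp : PlaysHistory h t p m)
    (q : G.Deviation → ℝ) :
    (∑ s ∈ Finset.range t, payoff (p s) q) + ∑ d, D.devNoise ξ t d * q d =
      ∑ d, q d * (∑ s ∈ Finset.range t, devGain (h s).1 d + D.devNoise ξ t d) := by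
  have h1 : ∑ s ∈ Finset.range t, payoff (p s) q =
      ∑ d, q d * ∑ s ∈ Finset.range t, devGain (h s).1 d := by
    simp only [Finset.mul_sum]
    rw [Finset.sum_comm]
    refine Finset.sum_congr rfl fun s hs => ?_
    rw [(hp s (Finset.mem_range.mp hs)).1, payoff]
    simp only [avgGain_pureStrategy]
  rw [h1]
  simp only [mul_add, Finset.sum_add_distrib]
  simp only [mul_comm]

theorem devReward_apply (e : G.Coalition × G.Profile) :
    devReward h t e = ∑ s ∈ Finset.range t, devGain (h s).1 (toDeviation e) := by
  simp [devReward]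

theorem dev_value_le_of_isLeader (ξ : D.NoiseIndex → ℝ) {e : G.Coalition × G.Profile}
    (he : IsLeader D.devOption (devReward h t) (D.devBlock ξ t) e) (d : G.Deviation) :
    ∑ s ∈ Finset.range t, devGain (h s).1 d + D.devNoise ξ t d ≤
      ∑ s ∈ Finset.range t, devGain (h s).1 (toDeviation e) +
        D.devNoise ξ t (toDeviation e) := by
  obtain ⟨e', rfl, hd⟩ := D.exists_devNoise_eq ξ t d
  have h1 := he e'
  have h2 := D.perturb_le_devNoise ξ t e
  rw [devReward_apply, devReward_apply] at h1
  linarith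

/-- Several pairs may induce the same deviation. Absence of ties between pairs still gives strict
optimality, because a different deviation is induced only by different pairs. -/
theorem dev_value_lt_of_isLeader (ξ : D.NoiseIndex → ℝ) {e : G.Coalition × G.Profile}
    (he : IsLeader D.devOption (devReward h t) (D.devBlock ξ t) e)
    (hn : ∀ e e', e ≠ e' → devReward h t e + perturb D.devOption (D.devBlock ξ t) e ≠
      devReward h t e' + perturb D.devOption (D.devBlock ξ t) e')
    {d : G.Deviation} (hd : d ≠ toDeviation e) :
    ∑ s ∈ Finset.range t, devGain (h s).1 d + D.devNoise ξ t d <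
      ∑ s ∈ Finset.range t, devGain (h s).1 (toDeviation e) +
        D.devNoise ξ t (toDeviation e) := by
  obtain ⟨e', rfl, hd'⟩ := D.exists_devNoise_eq ξ t d
  have h1 := lt_of_le_of_ne (he e') (hn e' e fun h => hd (by rw [h]))
  have h2 := D.perturb_le_devNoise ξ t e
  rw [devReward_apply, devReward_apply] at h1
  linarith

/-- A pure play by leaders is a round of the dynamics. -/
theorem round_of_isLeader (ξ : D.NoiseIndex → ℝ) (hp : PlaysHistory h t p m)
    {a : G.Profile} {e : G.Coalition × G.Profile}
    (ha : IsLeader D.corrOption (corrReward h t) (D.corrBlock ξ t) a)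
    (he : IsLeader D.devOption (devReward h t) (D.devBlock ξ t) e) :
    (pureStrategy a ∈ stdSimplex ℝ G.Profile ∧
      IsMinOn (fun q : G.Profile → ℝ => (∑ s ∈ Finset.range t, payoff q (m s))
        - ∑ a, D.corrNoise ξ t a * q a) (stdSimplex ℝ G.Profile) (pureStrategy a)) ∧
    (pureStrategy (toDeviation e) ∈ stdSimplex ℝ G.Deviation ∧
      IsMaxOn (fun q : G.Deviation → ℝ => (∑ s ∈ Finset.range t, payoff (p s) q)
        + ∑ d, D.devNoise ξ t d * q d) (stdSimplex ℝ G.Deviation)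
          (pureStrategy (toDeviation e))) := by
  refine ⟨⟨pureStrategy_mem_stdSimplex _, fun q hq => ?_⟩,
    ⟨pureStrategy_mem_stdSimplex _, fun q hq => ?_⟩⟩
  · simp only [Set.mem_ofPred_eq, D.corr_objective ξ hp, sum_pureStrategy_mul, neg_le_neg_iff]
    exact sum_mul_le_of_mem_stdSimplex hq ha
  · simp only [Set.mem_ofPred_eq, D.dev_objective ξ hp, sum_pureStrategy_mul]
    exact sum_mul_le_of_mem_stdSimplex hq (D.dev_value_le_of_isLeader ξ he)

/-- Without ties, a round of the dynamics is the pure play of the leaders. -/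
theorem eq_pureStrategy_of_round (ξ : D.NoiseIndex → ℝ) (hp : PlaysHistory h t p m)
    (hac : ∀ e e', e ≠ e' → corrReward h t e + perturb D.corrOption (D.corrBlock ξ t) e ≠
      corrReward h t e' + perturb D.corrOption (D.corrBlock ξ t) e')
    (had : ∀ e e', e ≠ e' → devReward h t e + perturb D.devOption (D.devBlock ξ t) e ≠
      devReward h t e' + perturb D.devOption (D.devBlock ξ t) e')
    {a : G.Profile} {e : G.Coalition × G.Profile}
    (ha : IsLeader D.corrOption (corrReward h t) (D.corrBlock ξ t) a)
    (he : IsLeader D.devOption (devReward h t) (D.devBlock ξ t) e)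
    (hround : (p t ∈ stdSimplex ℝ G.Profile ∧
      IsMinOn (fun q : G.Profile → ℝ => (∑ s ∈ Finset.range t, payoff q (m s))
        - ∑ a, D.corrNoise ξ t a * q a) (stdSimplex ℝ G.Profile) (p t)) ∧
    (m t ∈ stdSimplex ℝ G.Deviation ∧
      IsMaxOn (fun q : G.Deviation → ℝ => (∑ s ∈ Finset.range t, payoff (p s) q)
        + ∑ d, D.devNoise ξ t d * q d) (stdSimplex ℝ G.Deviation) (m t))) :
    p t = pureStrategy a ∧ m t = pureStrategy (toDeviation e) := by
  obtain ⟨⟨hpt, hmin⟩, hmt, hmax⟩ := hround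
  refine ⟨eq_pureStrategy_of_maximal hpt ?_
      fun a' ha' => lt_of_le_of_ne (ha a') (hac a' a ha'),
    eq_pureStrategy_of_maximal hmt
      (v := fun d => ∑ s ∈ Finset.range t, devGain (h s).1 d + D.devNoise ξ t d)
      ?_ fun d hd => D.dev_value_lt_of_isLeader ξ he had hd⟩
  · have := hmin (pureStrategy_mem_stdSimplex a)
    simpa only [Set.mem_ofPred_eq, D.corr_objective ξ hp, sum_pureStrategy_mul,
      neg_le_neg_iff] using this
  · have := hmax (pureStrategy_mem_stdSimplex (toDeviation e))
    simpa only [Set.mem_ofPred_eq, D.dev_objective ξ hp, sum_pureStrategy_mul] using this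

end Round

end RootedDecomposition

/-! ### A finite adapted process -/

/-- Extension of a finite sequence by an arbitrary value. -/
def extendSeq {X : Type} [Nonempty X] {T : ℕ} (g : Fin T → X) : ℕ → X :=
  fun t => if h : t < T then g ⟨t, h⟩ else Classical.arbitrary X

/-- Hoeffding's lemma for finitely many values in `[-2, 2]`. -/
theorem sum_mul_exp_le {X : Type} [Fintype X] {w z : X → ℝ} (hw0 : ∀ x, 0 ≤ w x)
    (hw1 : ∑ x, w x = 1) (hz : ∀ x, |z x| ≤ 2) (hmean : ∑ x, w x * z x = 0) (r : ℝ) :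
    ∑ x, w x * Real.exp (r * z x) ≤ Real.exp (2 * r ^ 2) := by
  have h1 : ∀ x, Real.exp (r * z x) ≤ Real.cosh (2 * r) + z x / 2 * Real.sinh (2 * r) := by
    intro x
    have h := Real.exp_mul_le_cosh_add_mul_sinh (t := z x / 2)
      (by rw [abs_div, abs_two]; linarith [hz x]) (2 * r)
    convert h using 2
    ring
  calc ∑ x, w x * Real.exp (r * z x)
      ≤ ∑ x, w x * (Real.cosh (2 * r) + z x / 2 * Real.sinh (2 * r)) :=
        Finset.sum_le_sum fun x _ => mul_le_mul_of_nonneg_left (h1 x) (hw0 x)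
    _ = (∑ x, w x) * Real.cosh (2 * r) + (∑ x, w x * z x) * (Real.sinh (2 * r) / 2) := by
        rw [Finset.sum_mul, Finset.sum_mul, ← Finset.sum_add_distrib]
        exact Finset.sum_congr rfl fun x _ => by ring
    _ = Real.cosh (2 * r) := by rw [hw1, hmean]; ring
    _ ≤ Real.exp ((2 * r) ^ 2 / 2) := Real.cosh_le_exp_half_sq _
    _ = _ := by ring_nf

section Adapted

variable {X : Type} [Nonempty X]

theorem extendSeq_snoc_of_lt {T : ℕ} (g : Fin T → X) (x : X) {t : ℕ} (ht : t < T) :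
    extendSeq (Fin.snoc (α := fun _ => X) g x) t = extendSeq g t := by
  simp [extendSeq, ht, Nat.lt_succ_of_lt ht, Fin.snoc]

theorem extendSeq_snoc_self {T : ℕ} (g : Fin T → X) (x : X) :
    extendSeq (Fin.snoc (α := fun _ => X) g x) T = x := by
  simp [extendSeq, Fin.snoc]

variable [Fintype X] {w z : (ℕ → X) → ℕ → X → ℝ}

/-- The exponential moment of an adapted sum. -/
theorem sum_prod_mul_exp_le (hw : ∀ h h' t, (∀ s < t, h s = h' s) → w h t = w h' t)
    (hz : ∀ h h' t, (∀ s < t, h s = h' s) → z h t = z h' t) (hw0 : ∀ h t x, 0 ≤ w h t x)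
    {r c : ℝ} (hstep : ∀ h t, ∑ x, w h t x * Real.exp (r * z h t x) ≤ c) (hc : 0 ≤ c) (T : ℕ) :
    ∑ g : Fin T → X, (∏ t ∈ Finset.range T, w (extendSeq g) t (extendSeq g t)) *
      Real.exp (r * ∑ t ∈ Finset.range T, z (extendSeq g) t (extendSeq g t)) ≤ c ^ T := by
  induction T with
  | zero => simp
  | succ T ih =>
    -- The last play is split off. Weights and increments depend only on earlier plays, so appending
    -- a play, or the arbitrary tail in `extendSeq`, changes no earlier factor.
    rw [← (Fin.snocEquiv fun _ : Fin (T + 1) => X).sum_comp, Fintype.sum_prod_type_right, pow_succ]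
    refine le_trans ?_ (mul_le_mul_of_nonneg_right ih hc)
    rw [Finset.sum_mul]
    refine Finset.sum_le_sum fun g _ => ?_
    have hlt : ∀ x : X, ∀ t, t < T → ∀ s, s < t →
        extendSeq (Fin.snoc (α := fun _ => X) g x) s = extendSeq g s :=
      fun x t ht s hs => extendSeq_snoc_of_lt g x (hs.trans ht)
    have hT : ∀ x : X, ∀ s < T, extendSeq (Fin.snoc (α := fun _ => X) g x) s = extendSeq g s :=
      fun x s hs => extendSeq_snoc_of_lt g x hs
    have key : ∀ x : X,
        (∏ t ∈ Finset.range (T + 1), w (extendSeq (Fin.snoc (α := fun _ => X) g x)) t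
          (extendSeq (Fin.snoc (α := fun _ => X) g x) t)) *
        Real.exp (r * ∑ t ∈ Finset.range (T + 1), z (extendSeq (Fin.snoc (α := fun _ => X) g x)) t
          (extendSeq (Fin.snoc (α := fun _ => X) g x) t)) =
        ((∏ t ∈ Finset.range T, w (extendSeq g) t (extendSeq g t)) *
          Real.exp (r * ∑ t ∈ Finset.range T, z (extendSeq g) t (extendSeq g t))) *
        (w (extendSeq g) T x * Real.exp (r * z (extendSeq g) T x)) := by
      intro x
      rw [Finset.prod_range_succ, Finset.sum_range_succ, extendSeq_snoc_self, mul_add,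
        Real.exp_add, hw _ _ T (hT x), hz _ _ T (hT x)]
      have h1 : ∏ t ∈ Finset.range T, w (extendSeq (Fin.snoc (α := fun _ => X) g x)) t
          (extendSeq (Fin.snoc (α := fun _ => X) g x) t) =
          ∏ t ∈ Finset.range T, w (extendSeq g) t (extendSeq g t) :=
        Finset.prod_congr rfl fun t ht => by
          have ht := Finset.mem_range.mp ht
          rw [hw _ _ t (hlt x t ht), hT x t ht]
      have h2 : ∑ t ∈ Finset.range T, z (extendSeq (Fin.snoc (α := fun _ => X) g x)) t
          (extendSeq (Fin.snoc (α := fun _ => X) g x) t) =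
          ∑ t ∈ Finset.range T, z (extendSeq g) t (extendSeq g t) :=
        Finset.sum_congr rfl fun t ht => by
          have ht := Finset.mem_range.mp ht
          rw [hz _ _ t (hlt x t ht), hT x t ht]
      rw [h1, h2]
      ring
    calc _ = ∑ x, ((∏ t ∈ Finset.range T, w (extendSeq g) t (extendSeq g t)) *
          Real.exp (r * ∑ t ∈ Finset.range T, z (extendSeq g) t (extendSeq g t))) *
        (w (extendSeq g) T x * Real.exp (r * z (extendSeq g) T x)) :=
          Finset.sum_congr rfl fun x _ => key x
      _ ≤ _ := by
          rw [← Finset.mul_sum]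
          refine mul_le_mul_of_nonneg_left (hstep _ _) (mul_nonneg ?_ (Real.exp_pos _).le)
          exact Finset.prod_nonneg fun _ _ => hw0 _ _ _

/-- The Azuma-Hoeffding bound for an adapted sum over a finite tree. -/
theorem sum_prod_le_of_tail
    (hw : ∀ h h' t, (∀ s < t, h s = h' s) → w h t = w h' t)
    (hz : ∀ h h' t, (∀ s < t, h s = h' s) → z h t = z h' t) (hw0 : ∀ h t x, 0 ≤ w h t x)
    (hw1 : ∀ h t, ∑ x, w h t x = 1) (hz2 : ∀ h t x, |z h t x| ≤ 2)
    (hmean : ∀ h t, ∑ x, w h t x * z h t x = 0) {T : ℕ} (hT : 0 < T) {δ : ℝ} (hδ : 0 < δ)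
    (hδ2 : δ ≤ 2) (s : Finset (Fin T → X))
    (hs : ∀ g ∈ s, 2 * √(2 * T * Real.log (2 / δ)) ≤
      ∑ t ∈ Finset.range T, z (extendSeq g) t (extendSeq g t)) :
    ∑ g ∈ s, ∏ t ∈ Finset.range T, w (extendSeq g) t (extendSeq g t) ≤ δ / 2 := by
  have hTpos : (0 : ℝ) < T := by exact_mod_cast hT
  set u : ℝ := 2 * √(2 * T * Real.log (2 / δ)) with hu
  have hlog : 0 ≤ Real.log (2 / δ) := Real.log_nonneg (by rwa [le_div_iff₀ hδ, one_mul])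
  have hu2 : u ^ 2 = 8 * T * Real.log (2 / δ) := by
    rw [hu, mul_pow, Real.sq_sqrt (by positivity)]
    ring
  -- This `r` minimizes `2 * r ^ 2 * T - r * u`; the minimum is `-u ^ 2 / (8 * T)`, which equals
  -- `-Real.log (2 / δ)`.
  set r : ℝ := u / (4 * T) with hr
  have hr0 : 0 ≤ r := by positivity
  have hmgf := sum_prod_mul_exp_le hw hz hw0 (r := r)
    (fun h t => sum_mul_exp_le (hw0 h t) (hw1 h t) (hz2 h t) (hmean h t) r)
    (Real.exp_pos _).le T
  have hprod : ∀ g : Fin T → X, 0 ≤ ∏ t ∈ Finset.range T, w (extendSeq g) t (extendSeq g t) :=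
    fun g => Finset.prod_nonneg fun _ _ => hw0 _ _ _
  have h1 : Real.exp (r * u) *
      ∑ g ∈ s, ∏ t ∈ Finset.range T, w (extendSeq g) t (extendSeq g t) ≤
      Real.exp (2 * r ^ 2) ^ T := by
    refine le_trans ?_ hmgf
    rw [Finset.mul_sum]
    refine (Finset.sum_le_sum fun g hg => ?_).trans (Finset.sum_le_sum_of_subset_of_nonneg
      (Finset.subset_univ s) fun g _ _ => mul_nonneg (hprod g) (Real.exp_pos _).le)
    rw [mul_comm]
    exact mul_le_mul_of_nonneg_left
      (Real.exp_le_exp.mpr (mul_le_mul_of_nonneg_left (hs g hg) hr0)) (hprod g)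
  have h2 : Real.exp (2 * r ^ 2) ^ T = Real.exp (r * u) * (δ / 2) := by
    rw [← Real.exp_nat_mul, show δ / 2 = Real.exp (-Real.log (2 / δ)) by
      rw [Real.exp_neg, Real.exp_log (by positivity), inv_div], ← Real.exp_add]
    congr 1
    have h3 : r * u = 2 * Real.log (2 / δ) := by
      rw [hr, div_mul_eq_mul_div, ← sq, hu2]
      field_simp
      ring
    have h4 : (T : ℝ) * (2 * r ^ 2) = r * u / 2 := by
      rw [hr]
      field_simp
      ring
    rw [h4, h3]
    ring
  rw [h2] at h1
  exact le_of_mul_le_mul_left h1 (Real.exp_pos _)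

end Adapted

/-! ### Independent blocks of noise -/

section Blocks

variable {Ω : Type*} [MeasurableSpace Ω] {P : Measure Ω} {κ : Type} {ξ : κ → Ω → ℝ} {η : ℝ}

theorem map_noise_eq [IsProbabilityMeasure P] (hlaw : ∀ k, HasLaw (ξ k) (expMeasure η) P)
    (hind : iIndepFun ξ P)
    {ι : Type} [Fintype ι] {j : ι → κ} (hj : Function.Injective j) :
    P.map (fun ω k => ξ (j k) ω) = expNoise ι η := by
  have h := (iIndepFun_iff_map_fun_eq_pi_map (f := fun k => ξ (j k))
    fun k => (hlaw (j k)).aemeasurable).mp (hind.precomp hj)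
  rw [h, expNoise]
  congr 1
  ext1 k
  exact (hlaw (j k)).map_eq

/-- Injectivity of the joint index map says that the blocks use disjoint noise variables. Currying
the product measure then makes the blocks independent. -/
theorem measure_blocks_eq [IsProbabilityMeasure P] (hη : 0 < η)
    (hlaw : ∀ k, HasLaw (ξ k) (expMeasure η) P) (hind : iIndepFun ξ P)
    {β : Type} [Fintype β] {ι : β → Type} [∀ i, Fintype (ι i)] {j : ∀ i, ι i → κ}
    (hj : Function.Injective fun p : Σ i, ι i => j p.1 p.2) {A : ∀ i, Set (ι i → ℝ)}
    (hA : ∀ i, MeasurableSet (A i)) :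
    P {ω | ∀ i, (fun k => ξ (j i k) ω) ∈ A i} = ∏ i, expNoise (ι i) η (A i) := by
  have := isProbabilityMeasure_expMeasure hη
  have hprob : ∀ i, IsProbabilityMeasure (expNoise (ι i) η) :=
    fun i => isProbabilityMeasure_expNoise hη
  have h1 := map_noise_eq hlaw hind hj
  have h2 := Measure.infinitePi_map_piCurry (X := fun (i : β) (_ : ι i) => ℝ)
    fun (_ : β) _ => expMeasure η
  simp only [Measure.infinitePi_eq_pi] at h2
  have h3 : P.map (fun ω i k => ξ (j i k) ω) = Measure.pi fun i => expNoise (ι i) η := by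
    unfold expNoise at h1 ⊢
    rw [← h2, ← h1, AEMeasurable.map_map_of_aemeasurable (MeasurableEquiv.measurable _).aemeasurable
      (aemeasurable_pi_lambda _ fun p => (hlaw _).aemeasurable)]
    rfl
  rw [← Measure.pi_pi, ← h3, Measure.map_apply_of_aemeasurable
    (aemeasurable_pi_lambda _ fun i => aemeasurable_pi_lambda _ fun k => (hlaw _).aemeasurable)
    (MeasurableSet.univ_pi hA)]
  congr 1
  ext ω
  simp

end Blocks

namespace RootedDecomposition

open Game

variable {N : ℕ} {G : Game N} (D : RootedDecomposition G)

/-! ### The random history of the dynamics -/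

/-- The law of the next play of the correlator. -/
def corrLaw (η : ℝ) (h : History G) (t : ℕ) : G.Profile → ℝ :=
  leaderProb D.corrOption η (corrReward h t)

/-- The law of the next play of the deviator. -/
def devLaw (η : ℝ) (h : History G) (t : ℕ) : G.Coalition × G.Profile → ℝ :=
  leaderProb D.devOption η (devReward h t)

theorem corrLaw_nonneg (η : ℝ) (h : History G) (t : ℕ) (a : G.Profile) :
    0 ≤ D.corrLaw η h t a :=
  leaderProb_nonneg _ _

theorem devLaw_nonneg (η : ℝ) (h : History G) (t : ℕ) (e : G.Coalition × G.Profile) :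
    0 ≤ D.devLaw η h t e :=
  leaderProb_nonneg _ _

/-- The deviator's law against the play of the correlator, minus the correlator's law against the
play of the deviator. -/
def surplus (η : ℝ) (h : History G) (t : ℕ) (x : G.Profile × (G.Coalition × G.Profile)) : ℝ :=
  ∑ e, D.devLaw η h t e * devGain x.1 (toDeviation e) -
    ∑ a, D.corrLaw η h t a * devGain a (toDeviation x.2)

/-- The plays of the history are leaders in the first `T` rounds. -/
def LeadersUpTo (ξ : D.NoiseIndex → ℝ) (h : History G) (T : ℕ) : Prop :=
  ∀ t < T, IsLeader D.corrOption (corrReward h t) (D.corrBlock ξ t) (h t).1 ∧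
    IsLeader D.devOption (devReward h t) (D.devBlock ξ t) (h t).2

/-- There are no ties in round `t` after the history `h`. -/
def NoTie (ξ : D.NoiseIndex → ℝ) (h : History G) (t : ℕ) : Prop :=
  (∀ e e', e ≠ e' → corrReward h t e + perturb D.corrOption (D.corrBlock ξ t) e ≠
    corrReward h t e' + perturb D.corrOption (D.corrBlock ξ t) e') ∧
  (∀ e e', e ≠ e' → devReward h t e + perturb D.devOption (D.devBlock ξ t) e ≠
    devReward h t e' + perturb D.devOption (D.devBlock ξ t) e')

theorem corrReward_congr {h h' : History G} {t : ℕ} (hh : ∀ s < t, h s = h' s) :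
    corrReward h t = corrReward h' t :=
  Finset.sum_congr rfl fun s hs => by rw [hh s (Finset.mem_range.mp hs)]

theorem devReward_congr {h h' : History G} {t : ℕ} (hh : ∀ s < t, h s = h' s) :
    devReward h t = devReward h' t :=
  Finset.sum_congr rfl fun s hs => by rw [hh s (Finset.mem_range.mp hs)]

theorem surplus_congr {η : ℝ} {h h' : History G} {t : ℕ} (hh : ∀ s < t, h s = h' s) :
    D.surplus η h t = D.surplus η h' t := by
  unfold surplus corrLaw devLaw
  rw [corrReward_congr hh, devReward_congr hh]

theorem LeadersUpTo.congr {ξ : D.NoiseIndex → ℝ} {h h' : History G} {T : ℕ}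
    (hh : ∀ s < T, h s = h' s) (hl : D.LeadersUpTo ξ h T) : D.LeadersUpTo ξ h' T := by
  intro t ht
  have hh' : ∀ s < t, h s = h' s := fun s hs => hh s (hs.trans ht)
  rw [← corrReward_congr hh', ← devReward_congr hh', ← hh t ht]
  exact hl t ht

theorem NoTie.congr {ξ : D.NoiseIndex → ℝ} {h h' : History G} {t : ℕ}
    (hh : ∀ s < t, h s = h' s) (hn : D.NoTie ξ h t) : D.NoTie ξ h' t := by
  unfold NoTie
  rw [← corrReward_congr hh, ← devReward_congr hh]
  exact hn

theorem extendSeq_restrict {X : Type} [Nonempty X] (h : ℕ → X) {T s : ℕ} (hs : s < T) :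
    extendSeq (fun t : Fin T => h t) s = h s := by
  simp [extendSeq, hs]

/-- Without ties, the dynamics is a sequence of pure plays by leaders. -/
theorem exists_history {ξ : D.NoiseIndex → ℝ} {T : ℕ} {p : ℕ → G.Profile → ℝ}
    {m : ℕ → G.Deviation → ℝ} (hf : D.FollowsFTPL ξ T p m)
    (hn : ∀ g : Fin T → G.Profile × (G.Coalition × G.Profile), ∀ t < T,
      D.NoTie ξ (extendSeq g) t) :
    ∃ g : Fin T → G.Profile × (G.Coalition × G.Profile),
      D.LeadersUpTo ξ (extendSeq g) T ∧ PlaysHistory (extendSeq g) T p m := by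
  have key : ∀ t ≤ T, ∃ h : History G, D.LeadersUpTo ξ h t ∧ PlaysHistory h t p m := by
    intro t
    induction t with
    | zero =>
      intro _
      exact ⟨fun _ => Classical.arbitrary _, fun t ht => absurd ht (Nat.not_lt_zero t),
        fun t ht => absurd ht (Nat.not_lt_zero t)⟩
    | succ t ih =>
      intro ht
      obtain ⟨h, hl, hp⟩ := ih (Nat.le_of_succ_le ht)
      obtain ⟨a, ha⟩ := exists_isLeader (φ := D.corrOption) (corrReward h t) (D.corrBlock ξ t)
      obtain ⟨e, he⟩ := exists_isLeader (φ := D.devOption) (devReward h t) (D.devBlock ξ t)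
      -- Ties in round `t` depend only on plays before `t`. So it is enough to exclude them for the
      -- finitely many histories of length `T`, which is what an almost sure statement can afford.
      have hnt : D.NoTie ξ h t := NoTie.congr D
        (fun s hs => extendSeq_restrict h (hs.trans ht)) (hn (fun t => h t) t ht)
      have hpt := D.eq_pureStrategy_of_round ξ hp hnt.1 hnt.2 ha he (hf t ht)
      have hh : ∀ s < t, h s = Function.update h t (a, e) s :=
        fun s hs => (Function.update_of_ne hs.ne _ _).symm
      refine ⟨Function.update h t (a, e), fun s hs => ?_, fun s hs => ?_⟩
      · rcases Nat.lt_succ_iff_lt_or_eq.mp hs with hs | rfl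
        · exact LeadersUpTo.congr D hh hl s hs
        · rw [← corrReward_congr hh, ← devReward_congr hh, Function.update_self]
          exact ⟨ha, he⟩
      · rcases Nat.lt_succ_iff_lt_or_eq.mp hs with hs | rfl
        · rw [← hh s hs]
          exact hp s hs
        · rw [Function.update_self]
          exact hpt
  obtain ⟨h, hl, hp⟩ := key T le_rfl
  have hh : ∀ s < T, h s = extendSeq (fun t : Fin T => h t) s :=
    fun s hs => (extendSeq_restrict h hs).symm
  exact ⟨fun t => h t, LeadersUpTo.congr D hh hl, fun s hs => by rw [← hh s hs]; exact hp s hs⟩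

/-! ### The law of the random history. -/

section Probability

variable {Ω : Type*} [MeasurableSpace Ω] {P : Measure Ω} [IsProbabilityMeasure P] {η : ℝ}
  {ξ : D.NoiseIndex → Ω → ℝ}

theorem ae_noTie (hη : 0 < η) (hlaw : ∀ k, HasLaw (ξ k) (expMeasure η) P)
    (hind : iIndepFun ξ P) (h : History G) (t : ℕ) :
    ∀ᵐ ω ∂P, D.NoTie (fun k => ξ k ω) h t := by
  have hc : Function.Injective fun k : Σ B, D.BagAct B =>
      (NoiseIndex.corr t k.1 k.2 : D.NoiseIndex) := by
    rintro ⟨B, a⟩ ⟨B', a'⟩ heq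
    simpa using heq
  have hd : Function.Injective fun k : Σ B, G.Coalition × D.BagAct B =>
      (NoiseIndex.dev t k.2.1 k.1 k.2.2 : D.NoiseIndex) := by
    rintro ⟨B, S, a⟩ ⟨B', S', a'⟩ heq
    simp only [NoiseIndex.dev.injEq, true_and] at heq
    obtain ⟨rfl, rfl, heq⟩ := heq
    simpa using heq
  have h1 := ae_no_tie hη D.corrOption_injective (corrReward h t)
  have h2 := ae_no_tie hη D.devOption_injective (devReward h t)
  rw [← map_noise_eq hlaw hind hc] at h1
  rw [← map_noise_eq hlaw hind hd] at h2
  filter_upwards [ae_of_ae_map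
    (aemeasurable_pi_lambda _ fun k => (hlaw _).aemeasurable) h1,
    ae_of_ae_map (aemeasurable_pi_lambda _ fun k => (hlaw _).aemeasurable) h2] with ω h3 h4
  exact ⟨h3, h4⟩

/-- The indices of the noise variables of one player in one round. -/
def BlockIndex (D : RootedDecomposition G) {T : ℕ} : Fin T ⊕ Fin T → Type
  | .inl _ => Σ B, D.BagAct B
  | .inr _ => Σ B, G.Coalition × D.BagAct B

instance {T : ℕ} : ∀ i : Fin T ⊕ Fin T, Fintype (D.BlockIndex i)
  | .inl _ => inferInstanceAs (Fintype (Σ B, D.BagAct B))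
  | .inr _ => inferInstanceAs (Fintype (Σ B, G.Coalition × D.BagAct B))

/-- The noise variable with a given place in a block. -/
def blockNoise {T : ℕ} : ∀ i : Fin T ⊕ Fin T, D.BlockIndex i → D.NoiseIndex
  | .inl t => fun k : Σ B, D.BagAct B => .corr t k.1 k.2
  | .inr t => fun k : Σ B, G.Coalition × D.BagAct B => .dev t k.2.1 k.1 k.2.2

theorem blockNoise_injective {T : ℕ} :
    Function.Injective fun p : Σ i : Fin T ⊕ Fin T, D.BlockIndex i => D.blockNoise p.1 p.2 := by
  rintro ⟨i | i, k⟩ ⟨i' | i', k'⟩ heq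
  · obtain ⟨B, a⟩ := k
    obtain ⟨B', a'⟩ := k'
    simp only [blockNoise, NoiseIndex.corr.injEq] at heq
    obtain ⟨h1, rfl, h2⟩ := heq
    obtain rfl := Fin.ext h1
    obtain rfl := eq_of_heq h2
    rfl
  · simp [blockNoise] at heq
  · simp [blockNoise] at heq
  · obtain ⟨B, S, a⟩ := k
    obtain ⟨B', S', a'⟩ := k'
    simp only [blockNoise, NoiseIndex.dev.injEq] at heq
    obtain ⟨h1, rfl, rfl, h2⟩ := heq
    obtain rfl := Fin.ext h1
    obtain rfl := eq_of_heq h2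
    rfl

/-- The noise for which the play of the history in a round leads, for one player. -/
def leaderSet (h : History G) {T : ℕ} : ∀ i : Fin T ⊕ Fin T, Set (D.BlockIndex i → ℝ)
  | .inl t => {n : (Σ B, D.BagAct B) → ℝ | IsLeader D.corrOption (corrReward h t) n (h t).1}
  | .inr t => {n : (Σ B, G.Coalition × D.BagAct B) → ℝ |
      IsLeader D.devOption (devReward h t) n (h t).2}

/-- Once the history is fixed, the cumulative rewards are deterministic. The event is then an
intersection of `2 * T` events, one per player and round, on disjoint blocks of noise. This replaces
conditional expectations. -/
theorem measure_leadersUpTo (hη : 0 < η) (hlaw : ∀ k, HasLaw (ξ k) (expMeasure η) P)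
    (hind : iIndepFun ξ P) (h : History G) (T : ℕ) :
    P {ω | D.LeadersUpTo (fun k => ξ k ω) h T} =
      ENNReal.ofReal (∏ t ∈ Finset.range T,
        D.corrLaw η h t (h t).1 * D.devLaw η h t (h t).2) := by
  have hc := isProbabilityMeasure_expNoise (ι := Σ B, D.BagAct B) hη
  have hd := isProbabilityMeasure_expNoise (ι := Σ B, G.Coalition × D.BagAct B) hη
  have hA : ∀ i : Fin T ⊕ Fin T, MeasurableSet (D.leaderSet h i) := by
    rintro (t | t)
    · exact measurableSet_isLeader (φ := D.corrOption) _ _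
    · exact measurableSet_isLeader (φ := D.devOption) _ _
  have h1 := measure_blocks_eq hη hlaw hind D.blockNoise_injective hA
  have h2 : {ω | D.LeadersUpTo (fun k => ξ k ω) h T} =
      {ω | ∀ i : Fin T ⊕ Fin T, (fun k => ξ (D.blockNoise i k) ω) ∈ D.leaderSet h i} := by
    ext ω
    simp only [Set.mem_ofPred_eq, Sum.forall]
    constructor
    · intro hl
      exact ⟨fun t => (hl t t.2).1, fun t => (hl t t.2).2⟩
    · intro hl t ht
      exact ⟨hl.1 ⟨t, ht⟩, hl.2 ⟨t, ht⟩⟩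
  have h3 : ∀ t : Fin T, expNoise (D.BlockIndex (T := T) (.inl t)) η (D.leaderSet h (.inl t)) =
      ENNReal.ofReal (D.corrLaw η h t (h t).1) := fun t =>
    (ofReal_measureReal (μ := expNoise (Σ B, D.BagAct B) η)
      (s := {n | IsLeader D.corrOption (corrReward h t) n (h t).1})).symm
  have h4 : ∀ t : Fin T, expNoise (D.BlockIndex (T := T) (.inr t)) η (D.leaderSet h (.inr t)) =
      ENNReal.ofReal (D.devLaw η h t (h t).2) := fun t =>
    (ofReal_measureReal (μ := expNoise (Σ B, G.Coalition × D.BagAct B) η)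
      (s := {n | IsLeader D.devOption (devReward h t) n (h t).2})).symm
  rw [h2, h1, Fintype.prod_sum_type]
  simp only [h3, h4]
  rw [← Finset.prod_mul_distrib, ← Fin.prod_univ_eq_prod_range
    (fun t => D.corrLaw η h t (h t).1 * D.devLaw η h t (h t).2),
    ENNReal.ofReal_prod_of_nonneg fun t _ => mul_nonneg (D.corrLaw_nonneg _ _ _ _)
      (D.devLaw_nonneg _ _ _ _)]
  exact Finset.prod_congr rfl fun t _ => (ENNReal.ofReal_mul (D.corrLaw_nonneg _ _ _ _)).symm

theorem sum_corrLaw (hη : 0 < η) (h : History G) (t : ℕ) : ∑ a, D.corrLaw η h t a = 1 :=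
  sum_leaderProb hη D.corrOption_injective _

theorem sum_devLaw (hη : 0 < η) (h : History G) (t : ℕ) : ∑ e, D.devLaw η h t e = 1 :=
  sum_leaderProb hη D.devOption_injective _

theorem abs_sum_mul_le_one {X : Type} [Fintype X] {w f : X → ℝ} (hw : ∀ x, 0 ≤ w x)
    (hw1 : ∑ x, w x = 1) (hf : ∀ x, |f x| ≤ 1) : |∑ x, w x * f x| ≤ 1 := by
  refine (Finset.abs_sum_le_sum_abs _ _).trans ?_
  rw [← hw1]
  refine Finset.sum_le_sum fun x _ => ?_
  rw [abs_mul, abs_of_nonneg (hw x)]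
  exact mul_le_of_le_one_right (hw x) (hf x)

theorem abs_surplus_le (hη : 0 < η) (h : History G) (t : ℕ)
    (x : G.Profile × (G.Coalition × G.Profile)) : |D.surplus η h t x| ≤ 2 := by
  have h1 := abs_sum_mul_le_one (fun e => D.devLaw_nonneg η h t e) (D.sum_devLaw hη h t)
    fun e => D.abs_devGain_toDeviation_le x.1 e
  have h2 := abs_sum_mul_le_one (fun a => D.corrLaw_nonneg η h t a) (D.sum_corrLaw hη h t)
    fun a => D.abs_devGain_toDeviation_le a x.2
  exact (abs_sub _ _).trans (by linarith)

/-- The two plays of a round are drawn independently, so both halves of the surplus average to the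
payoff of the two laws against each other. -/
theorem sum_law_mul_surplus (hη : 0 < η) (h : History G) (t : ℕ) :
    ∑ x : G.Profile × (G.Coalition × G.Profile),
      D.corrLaw η h t x.1 * D.devLaw η h t x.2 * D.surplus η h t x = 0 := by
  simp only [surplus, mul_sub, Finset.sum_sub_distrib]
  rw [sub_eq_zero, Fintype.sum_prod_type, Fintype.sum_prod_type_right]
  have h1 : ∀ a : G.Profile, ∑ e, D.corrLaw η h t a * D.devLaw η h t e *
      (∑ e', D.devLaw η h t e' * devGain a (toDeviation e')) =
      ∑ e', D.corrLaw η h t a * D.devLaw η h t e' * devGain a (toDeviation e') := by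
    intro a
    rw [← Finset.sum_mul, ← Finset.mul_sum, D.sum_devLaw hη, mul_one, Finset.mul_sum]
    exact Finset.sum_congr rfl fun _ _ => by ring
  have h2 : ∀ e : G.Coalition × G.Profile, ∑ a, D.corrLaw η h t a * D.devLaw η h t e *
      (∑ a', D.corrLaw η h t a' * devGain a' (toDeviation e)) =
      ∑ a', D.corrLaw η h t a' * D.devLaw η h t e * devGain a' (toDeviation e) := by
    intro e
    rw [← Finset.sum_mul, ← Finset.sum_mul, D.sum_corrLaw hη, one_mul, Finset.mul_sum]
    exact Finset.sum_congr rfl fun _ _ => by ring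
  simp only [h1, h2]
  exact Finset.sum_comm

/-- With high probability, the dynamics is a sequence of pure plays with small total surplus. -/
theorem measure_exists_history (hη : 0 < η) (hlaw : ∀ k, HasLaw (ξ k) (expMeasure η) P)
    (hind : iIndepFun ξ P) {T : ℕ} (hT : 0 < T) {δ : ℝ} (hδ : 0 < δ) (hδ2 : δ ≤ 2)
    {p : ℕ → Ω → G.Profile → ℝ} {m : ℕ → Ω → G.Deviation → ℝ}
    (hf : ∀ᵐ ω ∂P, D.FollowsFTPL (fun k => ξ k ω) T (fun t => p t ω) (fun t => m t ω)) :
    ENNReal.ofReal (1 - δ) ≤ P {ω | ∃ h : History G,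
      PlaysHistory h T (fun t => p t ω) (fun t => m t ω) ∧
      ∑ t ∈ Finset.range T, D.surplus η h t (h t) ≤ 2 * √(2 * T * Real.log (2 / δ))} := by
  classical
  set good : Set Ω := {ω | ∃ h : History G,
      PlaysHistory h T (fun t => p t ω) (fun t => m t ω) ∧
      ∑ t ∈ Finset.range T, D.surplus η h t (h t) ≤ 2 * √(2 * T * Real.log (2 / δ))} with hgood
  set bad : Finset (Fin T → G.Profile × (G.Coalition × G.Profile)) :=
    Finset.univ.filter fun g => 2 * √(2 * T * Real.log (2 / δ)) ≤
      ∑ t ∈ Finset.range T, D.surplus η (extendSeq g) t (extendSeq g t) with hbad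
  have htie : ∀ᵐ ω ∂P, ∀ g : Fin T → G.Profile × (G.Coalition × G.Profile), ∀ t,
      D.NoTie (fun k => ξ k ω) (extendSeq g) t := by
    rw [ae_all_iff]
    intro g
    rw [ae_all_iff]
    intro t
    exact D.ae_noTie hη hlaw hind _ t
  -- Off the good set the realized history itself must lie in `bad`, so the union over the finitely
  -- many bad histories covers almost every such outcome.
  have hcover : ∀ᵐ ω ∂P, ω ∈ goodᶜ →
      ω ∈ ⋃ g ∈ bad, {ω | D.LeadersUpTo (fun k => ξ k ω) (extendSeq g) T} := by
    filter_upwards [hf, htie] with ω h1 h2 hω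
    obtain ⟨g, hl, hp⟩ := D.exists_history h1 fun g t _ => h2 g t
    refine Set.mem_biUnion (x := g) ?_ hl
    simp only [hbad, Finset.coe_filter, Finset.mem_univ, true_and, Set.mem_ofPred_eq]
    by_contra hlt
    exact hω ⟨extendSeq g, hp, (not_le.mp hlt).le⟩
  have htail := sum_prod_le_of_tail (w := fun h t x => D.corrLaw η h t x.1 * D.devLaw η h t x.2)
    (z := fun h t x => D.surplus η h t x)
    (fun h h' t hh => by
      unfold corrLaw devLaw
      rw [corrReward_congr hh, devReward_congr hh])
    (fun h h' t hh => D.surplus_congr hh)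
    (fun h t x => mul_nonneg (D.corrLaw_nonneg _ _ _ _) (D.devLaw_nonneg _ _ _ _))
    (fun h t => by
      rw [Fintype.sum_prod_type]
      simp only [← Finset.mul_sum, D.sum_devLaw hη, mul_one, D.sum_corrLaw hη])
    (fun h t x => D.abs_surplus_le hη h t x)
    (fun h t => D.sum_law_mul_surplus hη h t) hT hδ hδ2 bad
    (fun g hg => (Finset.mem_filter.mp hg).2)
  have hcompl : P goodᶜ ≤ ENNReal.ofReal (δ / 2) := by
    refine (measure_mono_ae hcover).trans ((measure_biUnion_finset_le _ _).trans ?_)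
    simp only [D.measure_leadersUpTo hη hlaw hind]
    rw [← ENNReal.ofReal_sum_of_nonneg fun g _ => Finset.prod_nonneg fun t _ =>
      mul_nonneg (D.corrLaw_nonneg _ _ _ _) (D.devLaw_nonneg _ _ _ _)]
    exact ENNReal.ofReal_le_ofReal htail
  -- The strategies are arbitrary functions of the outcome, so `good` need not be measurable;
  -- subadditivity is enough.
  have htotal : (1 : ENNReal) ≤ P good + P goodᶜ := by
    rw [← measure_univ (μ := P), ← Set.union_compl_self good]
    exact measure_union_le _ _
  rw [ENNReal.ofReal_sub _ hδ.le, ENNReal.ofReal_one, tsub_le_iff_right]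
  refine htotal.trans (add_le_add le_rfl (hcompl.trans (ENNReal.ofReal_le_ofReal ?_)))
  linarith

end Probability

/-! ### From small surplus to small exploitability -/

/-- The sum of the regret bounds of the two players. -/
def regretBound (η : ℝ) (T : ℕ) : ℝ :=
  4 / (3 * η) * (Real.log (Fintype.card G.Profile) + D.K * Real.log 4) +
    4 / (3 * η) * (Real.log (Fintype.card (G.Coalition × G.Profile)) + D.K * Real.log 4) +
    4 * η * T

/-- Sum of the two regret bounds along one fixed history. Each regret uses the law of the player's
own leader against the plays of the opponent in that history, so the two expected rewards add up to
the surplus. -/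
theorem sum_devGain_sub_le {η : ℝ} (hη : 0 < η) (h : History G) (T : ℕ) (a : G.Profile)
    (e : G.Coalition × G.Profile) :
    ∑ t ∈ Finset.range T, devGain (h t).1 (toDeviation e) -
      ∑ t ∈ Finset.range T, devGain a (toDeviation (h t).2) ≤
      ∑ t ∈ Finset.range T, D.surplus η h t (h t) + D.regretBound η T := by
  have h1 := leader_regret hη D.corrOption_injective
    (fun t => -fun a => devGain a (toDeviation (h t).2)) (fun t => (D.regular_corr _).2)
    (fun t => by rw [neg_neg]; exact (D.regular_corr _).1)
    (fun t a => by rw [Pi.neg_apply, abs_neg]; exact D.abs_devGain_toDeviation_le _ _) T a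
  have h2 := leader_regret hη D.devOption_injective
    (fun t e => devGain (h t).1 (toDeviation e)) (fun t => (D.regular_dev _).1)
    (fun t => (D.regular_dev _).2) (fun t e => D.abs_devGain_toDeviation_le _ _) T e
  have h3 : ∑ t ∈ Finset.range T, D.surplus η h t (h t) =
      ∑ t ∈ Finset.range T, ∑ e', leaderProb D.devOption η (devReward h t) e' *
        devGain (h t).1 (toDeviation e') +
      ∑ t ∈ Finset.range T, ∑ a', leaderProb D.corrOption η (corrReward h t) a' *
        (-fun a => devGain a (toDeviation (h t).2)) a' := by
    simp only [surplus, corrLaw, devLaw, Pi.neg_apply, mul_neg, Finset.sum_neg_distrib,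
      Finset.sum_sub_distrib]
    ring
  have h4 : ∑ t ∈ Finset.range T, (-fun a => devGain a (toDeviation (h t).2)) a =
      -∑ t ∈ Finset.range T, devGain a (toDeviation (h t).2) := by
    simp only [Pi.neg_apply, Finset.sum_neg_distrib]
  rw [h4] at h1
  rw [h3, regretBound]
  simp only [corrReward, devReward]
  linarith

theorem avgGain_average {h : History G} {T : ℕ} {p : ℕ → G.Profile → ℝ}
    {m : ℕ → G.Deviation → ℝ} (hp : PlaysHistory h T p m) (d : G.Deviation) :
    avgGain (average T p) d = 1 / T * ∑ t ∈ Finset.range T, devGain (h t).1 d := by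
  have h1 : ∀ t ∈ Finset.range T, devGain (h t).1 d = ∑ a, p t a * devGain a d := by
    intro t ht
    rw [(hp t (Finset.mem_range.mp ht)).1, sum_pureStrategy_mul]
  rw [Finset.sum_congr rfl h1, avgGain_eq, Finset.sum_comm, Finset.mul_sum]
  refine Finset.sum_congr rfl fun a _ => ?_
  rw [average, mul_assoc, Finset.sum_mul]

/-- The guarantee of the averaged strategy along a history. -/
theorem payoff_average_le {η : ℝ} (hη : 0 < η) {h : History G} {T : ℕ} (hT : 0 < T)
    {p : ℕ → G.Profile → ℝ} {m : ℕ → G.Deviation → ℝ} (hp : PlaysHistory h T p m)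
    {pStar : G.Profile → ℝ} {mStar : G.Deviation → ℝ} (hs : IsMinMaxSolution pStar mStar)
    {mHat : G.Deviation → ℝ} (hm : mHat ∈ stdSimplex ℝ G.Deviation) :
    payoff (average T p) mHat ≤ payoff pStar mStar +
      (∑ t ∈ Finset.range T, D.surplus η h t (h t) + D.regretBound η T) / T := by
  have hTpos : (0 : ℝ) < T := by exact_mod_cast hT
  refine sum_mul_le_of_mem_stdSimplex hm fun d => ?_
  obtain ⟨e, rfl⟩ : ∃ e, toDeviation e = d :=
    ⟨_, toDeviation_override d fun _ => Classical.arbitrary _⟩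
  rw [avgGain_average hp]
  set u : ℝ := ∑ t ∈ Finset.range T, D.surplus η h t (h t) + D.regretBound η T with hu
  set g : ℝ := ∑ t ∈ Finset.range T, devGain (h t).1 (toDeviation e) with hg
  have h1 : ∀ a, g - u ≤ ∑ t ∈ Finset.range T, devGain a (toDeviation (h t).2) := fun a => by
    have := D.sum_devGain_sub_le hη h T a e
    linarith
  have h2 : g - u ≤ ∑ a, pStar a * ∑ t ∈ Finset.range T, devGain a (toDeviation (h t).2) := by
    calc g - u = ∑ a, pStar a * (g - u) := by rw [← Finset.sum_mul, hs.1.2, one_mul]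
      _ ≤ _ := Finset.sum_le_sum fun a _ => mul_le_mul_of_nonneg_left (h1 a) (hs.1.1 a)
  -- Against `pStar` no past deviation earns more than the value of the min-max solution.
  have h3 : ∑ a, pStar a * ∑ t ∈ Finset.range T, devGain a (toDeviation (h t).2) ≤
      T * payoff pStar mStar := by
    simp only [Finset.mul_sum]
    rw [Finset.sum_comm]
    calc _ ≤ ∑ t ∈ Finset.range T, payoff pStar mStar := by
          refine Finset.sum_le_sum fun t _ => ?_
          rw [← avgGain_eq, ← payoff_pureStrategy]
          exact hs.2.2.1 _ (pureStrategy_mem_stdSimplex _)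
      _ = _ := by simp
  have h4 : g ≤ T * payoff pStar mStar + u := by linarith
  calc 1 / (T : ℝ) * g ≤ 1 / T * (T * payoff pStar mStar + u) :=
        mul_le_mul_of_nonneg_left h4 (by positivity)
    _ = _ := by field_simp

end RootedDecomposition

/-! ### Sizes -/

namespace Game

variable {N : ℕ} {G : Game N}

theorem card_local_le (C : Finset (Fin N)) : Fintype.card (G.Local C) ≤ G.maxActions ^ C.card := by
  rw [Fintype.card_pi]
  calc ∏ i : C, Fintype.card (G.Act i) ≤ ∏ _i : C, G.maxActions :=
        Finset.prod_le_prod' fun i _ => card_act_le_maxActions i.1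
    _ = _ := by simp

theorem card_profile_le : Fintype.card G.Profile ≤ G.maxActions ^ N := by
  rw [Fintype.card_pi]
  calc ∏ i, Fintype.card (G.Act i) ≤ ∏ _i : Fin N, G.maxActions :=
        Finset.prod_le_prod' fun i _ => card_act_le_maxActions i
    _ = _ := by simp

theorem players_pos (G : Game N) : 0 < N := by
  obtain ⟨S, hS⟩ := G.coalitions_nonempty
  obtain ⟨i, _⟩ := G.coalition_nonempty S hS
  exact i.pos

theorem maxActions_pos (G : Game N) : 0 < G.maxActions :=
  (Fintype.card_pos (α := G.Act ⟨0, G.players_pos⟩)).trans_le (card_act_le_maxActions _)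

theorem card_coalition_le : Fintype.card G.Coalition ≤ 2 ^ N := by
  simpa using Finset.card_le_univ G.coalitions

theorem subsingleton_profile (h : G.maxActions ≤ 1) : Subsingleton G.Profile := by
  have : ∀ i, Subsingleton (G.Act i) := fun i =>
    Fintype.card_le_one_iff_subsingleton.mp ((card_act_le_maxActions i).trans h)
  infer_instance

/-- The case of single actions is separate: there `log A = 0` cannot absorb the logarithm of the
number of coalitions, nor the number of bags in the second bound. -/
theorem avgGain_eq_zero (h : G.maxActions ≤ 1) (p : G.Profile → ℝ) (d : G.Deviation) :
    avgGain p d = 0 := by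
  have := subsingleton_profile h
  have hov : ∀ a : G.Profile, override d.2 a = a := fun a => Subsingleton.elim _ _
  simp [avgGain, hov]

theorem payoff_eq_zero (h : G.maxActions ≤ 1) (p : G.Profile → ℝ) (m : G.Deviation → ℝ) :
    payoff p m = 0 := by
  simp [payoff, avgGain_eq_zero h]

/-! ### Exploitability and solutions of the meta-game -/

instance : Nonempty G.Deviation := ⟨⟨Classical.arbitrary _, fun _ => Classical.arbitrary _⟩⟩

theorem avgGain_le_exploitability (p : G.Profile → ℝ) (d : G.Deviation) :
    avgGain p d ≤ exploitability p :=
  le_ciSup (Set.finite_range _).bddAbove d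

theorem exists_avgGain_eq (p : G.Profile → ℝ) : ∃ d, avgGain p d = exploitability p :=
  exists_eq_ciSup_of_finite

/-- A pure best deviation serves as `m`. The definition of a min-max solution does not ask for a
saddle point, so no minimax theorem is needed. -/
theorem IsMASE.isMinMaxSolution {q : G.Profile → ℝ} (hq : IsMASE q) :
    ∃ m, IsMinMaxSolution q m ∧ payoff q m = exploitability q := by
  obtain ⟨d, hd⟩ := exists_avgGain_eq q
  refine ⟨pureStrategy d, ⟨hq.1, pureStrategy_mem_stdSimplex d, fun m₂ hm₂ => ?_, fun p₂ hp₂ => ?_⟩,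
    by rw [payoff_pureStrategy, hd]⟩
  · rw [payoff_pureStrategy, hd]
    exact sum_mul_le_of_mem_stdSimplex hm₂ (avgGain_le_exploitability q)
  · obtain ⟨d₂, hd₂⟩ := exists_avgGain_eq p₂
    refine ⟨pureStrategy d₂, pureStrategy_mem_stdSimplex d₂, ?_⟩
    rw [payoff_pureStrategy, payoff_pureStrategy, hd, hd₂]
    exact hq.2 p₂ hp₂

end Game

namespace RootedDecomposition

open Game

variable {N : ℕ} {G : Game N} (D : RootedDecomposition G)

theorem card_bag_le (B : Fin D.K) : (D.bag B).card ≤ D.width + 1 := by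
  have := Finset.le_sup (f := fun B => (D.bag B).card) (Finset.mem_univ B)
  simp only [TreeDecomposition.width]
  omega

/-- The bags cover the players; this turns `N * log A` into the bound in bags and width. -/
theorem players_le : N ≤ D.K * (D.width + 1) := by
  calc N = (Finset.univ : Finset (Fin N)).card := by simp
    _ ≤ (Finset.univ.biUnion D.bag).card := by
        refine Finset.card_le_card fun i _ => ?_
        obtain ⟨B, hB⟩ := D.cover i
        exact Finset.mem_biUnion.mpr ⟨B, Finset.mem_univ B, hB⟩
    _ ≤ ∑ B, (D.bag B).card := Finset.card_biUnion_le
    _ ≤ ∑ _B : Fin D.K, (D.width + 1) := Finset.sum_le_sum fun B _ => D.card_bag_le B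
    _ = _ := by simp

theorem one_le_bags : (1 : ℝ) ≤ D.K := by
  exact_mod_cast D.root.pos

theorem log_maxActions_nonneg : 0 ≤ Real.log G.maxActions := Real.log_natCast_nonneg _

theorem log_card_profile_le :
    Real.log (Fintype.card G.Profile) ≤ D.K * ((D.width + 1) * Real.log G.maxActions) := by
  calc Real.log (Fintype.card G.Profile) ≤ Real.log ((G.maxActions : ℝ) ^ N) := by
        refine Real.log_le_log (by exact_mod_cast Fintype.card_pos) ?_
        exact_mod_cast card_profile_le
    _ = N * Real.log G.maxActions := by rw [Real.log_pow]
    _ ≤ ((D.K * (D.width + 1) : ℕ) : ℝ) * Real.log G.maxActions :=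
        mul_le_mul_of_nonneg_right (by exact_mod_cast D.players_le) log_maxActions_nonneg
    _ = _ := by push_cast; ring

theorem log_card_coalition_le (h2 : 2 ≤ G.maxActions) :
    Real.log (Fintype.card G.Coalition) ≤ D.K * ((D.width + 1) * Real.log G.maxActions) := by
  calc Real.log (Fintype.card G.Coalition) ≤ Real.log ((G.maxActions : ℝ) ^ N) := by
        refine Real.log_le_log (by exact_mod_cast Fintype.card_pos) ?_
        exact_mod_cast card_coalition_le.trans (Nat.pow_le_pow_left h2 N)
    _ = N * Real.log G.maxActions := by rw [Real.log_pow]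
    _ ≤ ((D.K * (D.width + 1) : ℕ) : ℝ) * Real.log G.maxActions :=
        mul_le_mul_of_nonneg_right (by exact_mod_cast D.players_le) log_maxActions_nonneg
    _ = _ := by push_cast; ring

theorem regretBound_le (h2 : 2 ≤ G.maxActions) {η : ℝ} (hη : 0 < η) (T : ℕ) :
    D.regretBound η T ≤ 4 * D.K * ((1 + (D.width + 1) * Real.log G.maxActions) / η) +
      4 * η * D.K * T := by
  have h1 := D.log_card_profile_le
  have h3 := D.log_card_coalition_le h2
  have hprod : Real.log (Fintype.card (G.Coalition × G.Profile)) =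
      Real.log (Fintype.card G.Coalition) + Real.log (Fintype.card G.Profile) := by
    rw [Fintype.card_prod, Nat.cast_mul, Real.log_mul
      (by exact_mod_cast Fintype.card_ne_zero) (by exact_mod_cast Fintype.card_ne_zero)]
  have h4 : Real.log 4 ≤ 3 / 2 := by
    rw [show (4 : ℝ) = 2 ^ 2 by norm_num, Real.log_pow]
    have := Real.log_two_lt_d9
    push_cast
    linarith
  have hK := D.one_le_bags
  have hKlog : D.K * Real.log 4 ≤ D.K * (3 / 2) := mul_le_mul_of_nonneg_left h4 (by linarith)
  have h5 : 4 * η * T ≤ 4 * η * D.K * T := by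
    have : 0 ≤ 4 * η * T := by positivity
    nlinarith
  rw [regretBound, hprod]
  set KL : ℝ := D.K * ((D.width + 1) * Real.log G.maxActions) with hKL
  calc _ = 4 / (3 * η) * (Real.log (Fintype.card G.Coalition) +
          2 * Real.log (Fintype.card G.Profile) + 2 * (D.K * Real.log 4)) + 4 * η * T := by ring
    -- One `KL` bounds the coalitions and two the profiles of the two players; the two terms `K *
    -- log 4` are at most `3 * K` together.
    _ ≤ 4 / (3 * η) * (3 * KL + 3 * D.K) + 4 * η * D.K * T := by
        refine add_le_add (mul_le_mul_of_nonneg_left ?_ (by positivity)) h5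
        linarith
    _ = _ := by
        rw [hKL]
        field_simp
        ring

theorem two_mul_sqrt_div {T : ℕ} (hT : 0 < T) (l : ℝ) :
    2 * √(2 * T * l) / T = 2 * √(2 * l / T) := by
  have hTpos : (0 : ℝ) < T := by exact_mod_cast hT
  rw [show 2 * (T : ℝ) * l = (T : ℝ) ^ 2 * (2 * l / T) by field_simp,
    Real.sqrt_mul (by positivity), Real.sqrt_sq hTpos.le]
  field_simp

/-- The guarantee for one history with small surplus. -/
theorem payoff_average_le_of_surplus_le {η δ : ℝ} (hη : 0 < η) {h : History G} {T : ℕ}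
    (hT : 0 < T) {p : ℕ → G.Profile → ℝ} {m : ℕ → G.Deviation → ℝ} (hp : PlaysHistory h T p m)
    (hsur : ∑ t ∈ Finset.range T, D.surplus η h t (h t) ≤ 2 * √(2 * T * Real.log (2 / δ)))
    {pStar : G.Profile → ℝ} {mStar : G.Deviation → ℝ} (hs : IsMinMaxSolution pStar mStar)
    {mHat : G.Deviation → ℝ} (hm : mHat ∈ stdSimplex ℝ G.Deviation) :
    payoff (average T p) mHat ≤ payoff pStar mStar +
      4 * D.K * ((1 + (D.width + 1) * Real.log G.maxActions) / (η * T)) + 4 * η * D.K +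
      2 * √(2 * Real.log (2 / δ) / T) := by
  have hTpos : (0 : ℝ) < T := by exact_mod_cast hT
  have hlog := log_maxActions_nonneg (G := G)
  rcases Nat.lt_or_ge 1 G.maxActions with h2 | h1
  · refine (D.payoff_average_le hη hT hp hs hm).trans ?_
    have h3 := div_le_div_of_nonneg_right (add_le_add hsur (D.regretBound_le h2 hη T)) hTpos.le
    rw [add_div (2 * _), two_mul_sqrt_div hT, add_div (4 * (D.K : ℝ) * _)] at h3
    have h4 : 4 * D.K * ((1 + (D.width + 1) * Real.log G.maxActions) / η) / T =
        4 * D.K * ((1 + (D.width + 1) * Real.log G.maxActions) / (η * T)) := by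
      field_simp
    have h5 : 4 * η * D.K * T / T = 4 * η * D.K := by field_simp
    rw [h4, h5] at h3
    linarith
  · rw [payoff_eq_zero h1, payoff_eq_zero h1]
    positivity

theorem average_mem_stdSimplex {h : History G} {T : ℕ} (hT : 0 < T) {p : ℕ → G.Profile → ℝ}
    {m : ℕ → G.Deviation → ℝ} (hp : PlaysHistory h T p m) :
    average T p ∈ stdSimplex ℝ G.Profile := by
  have hTpos : (0 : ℝ) < T := by exact_mod_cast hT
  have hmem : ∀ t ∈ Finset.range T, p t ∈ stdSimplex ℝ G.Profile := fun t ht => by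
    rw [(hp t (Finset.mem_range.mp ht)).1]
    exact pureStrategy_mem_stdSimplex _
  refine ⟨fun a => mul_nonneg (by positivity) (Finset.sum_nonneg fun t ht => (hmem t ht).1 a), ?_⟩
  simp only [average]
  rw [← Finset.mul_sum, Finset.sum_comm, Finset.sum_congr rfl fun t ht => (hmem t ht).2]
  simp [hTpos.ne']

theorem isApproxMASE_of_surplus_le {C δ : ℝ} (hC : 20 ≤ C) {h : History G} {T : ℕ} (hT : 0 < T)
    {p : ℕ → G.Profile → ℝ} {m : ℕ → G.Deviation → ℝ} (hp : PlaysHistory h T p m)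
    (hsur : ∑ t ∈ Finset.range T, D.surplus (1 / √T) h t (h t) ≤
      2 * √(2 * T * Real.log (2 / δ))) :
    IsApproxMASE (C * ((D.K * (D.width + 1) * Real.log G.maxActions +
      √(Real.log (2 / δ))) / √T)) (average T p) := by
  have hTpos : (0 : ℝ) < T := by exact_mod_cast hT
  have hsq : 0 < √(T : ℝ) := Real.sqrt_pos.mpr hTpos
  have hlog := log_maxActions_nonneg (G := G)
  have hK := D.one_le_bags
  refine ⟨average_mem_stdSimplex hT hp, fun q hq => ?_⟩
  obtain ⟨d, hd⟩ := exists_avgGain_eq (average T p)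
  rcases Nat.lt_or_ge 1 G.maxActions with h2 | h1
  · obtain ⟨mStar, hs, hval⟩ := hq.isMinMaxSolution
    have h3 := D.payoff_average_le_of_surplus_le (by positivity) hT hp hsur hs
      (pureStrategy_mem_stdSimplex d)
    rw [payoff_pureStrategy, hd, hval] at h3
    refine h3.trans ?_
    rw [add_assoc, add_assoc]
    refine add_le_add le_rfl ?_
    have hTs : 1 / √(T : ℝ) * T = √T := by
      rw [div_mul_eq_mul_div, one_mul, Real.div_sqrt]
    have h4 : √(2 * Real.log (2 / δ) / T) = √2 * √(Real.log (2 / δ)) / √T := by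
      rw [Real.sqrt_div' _ hTpos.le, Real.sqrt_mul zero_le_two]
    have h5 : √2 ≤ 2 := by
      rw [Real.sqrt_le_left zero_le_two]
      norm_num
    have h6 : 1 / 2 ≤ Real.log G.maxActions := by
      have := Real.log_two_gt_d9
      have h7 : Real.log 2 ≤ Real.log G.maxActions :=
        Real.log_le_log zero_lt_two (by exact_mod_cast h2)
      linarith
    rw [hTs, h4]
    set W : ℝ := D.K * (D.width + 1) * Real.log G.maxActions with hW
    set s : ℝ := √(Real.log (2 / δ)) with hsdef
    have hs0 : 0 ≤ s := Real.sqrt_nonneg _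
    have hKW : (D.K : ℝ) ≤ 2 * W := by
      have : (D.K : ℝ) * 1 ≤ D.K * (D.width + 1) :=
        mul_le_mul_of_nonneg_left (by linarith [Nat.cast_nonneg (α := ℝ) D.width]) (by linarith)
      rw [hW]
      nlinarith
    -- As `log A ≥ 1/2`, `K ≤ 2 * W` and the first two terms are at most `20 * W`; the root
    -- contributes at most `4 * s`. This is where `20 ≤ C` is used.
    have hnum : 8 * D.K + 4 * W + 2 * (√2 * s) ≤ C * (W + s) := by
      have h8 : √2 * s ≤ 2 * s := mul_le_mul_of_nonneg_right h5 hs0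
      have h9 : 20 * (W + s) ≤ C * (W + s) := mul_le_mul_of_nonneg_right hC (by linarith)
      linarith
    calc _ = (8 * D.K + 4 * W + 2 * (√2 * s)) / √T := by
          rw [hW]
          ring
      _ ≤ C * (W + s) / √T := div_le_div_of_nonneg_right hnum hsq.le
      _ = _ := by ring
  · rw [← hd, avgGain_eq_zero h1]
    obtain ⟨d', hd'⟩ := exists_avgGain_eq q
    rw [← hd', avgGain_eq_zero h1, zero_add]
    have : 0 ≤ C := by linarith
    positivity

end RootedDecomposition

/-! ### Results and costs of the elementary loops -/

namespace Timed

@[simp] theorem evals_pure {α : Type} (x : α) : (pure x : Timed α).evals = 0 := rfl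

@[simp] theorem evals_bind {α β : Type} (x : Timed α) (f : α → Timed β) :
    (x >>= f).evals = x.evals + (f x.val).evals := rfl

@[simp] theorem evals_op {α : Type} (x : α) : (op x).evals = 0 := rfl

section Loops

variable {ι : Type}

@[simp] theorem evals_tabulate [Fintype ι] {β : ι → Type} (f : ∀ k, Timed (β k)) :
    (tabulate f).evals = ∑ k, (f k).evals := rfl

@[simp] theorem evals_store [DecidableEq ι] {β : ι → Type} (s : Finset ι) (old : ∀ k, β k)
    (f : ∀ k, Timed (β k)) : (store s old f).evals = ∑ k ∈ s, (f k).evals := rfl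

@[simp] theorem evals_sum (s : Finset ι) (f : ι → Timed ℝ) :
    (sum s f).evals = ∑ k ∈ s, (f k).evals := rfl

@[simp] theorem evals_argmax [Nonempty ι] (s : Finset ι) (f : ι → Timed ℝ) :
    (argmax s f).evals = ∑ k ∈ s, (f k).evals := rfl

theorem argmax_spec [Nonempty ι] {s : Finset ι} (hs : s.Nonempty) (f : ι → Timed ℝ) :
    (argmax s f).val ∈ s ∧ ∀ k ∈ s, (f k).val ≤ (f (argmax s f).val).val := by
  simp only [argmax, hs, dif_pos]
  exact (s.exists_max_image (fun k => (f k).val) hs).choose_spec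

end Loops

end Timed

/-! ### Partial joint actions -/

namespace Game

variable {N : ℕ} {G : Game N}

theorem extend_apply_of_mem {C : Finset (Fin N)} (b : G.Local C) {i : Fin N} (hi : i ∈ C) :
    Game.extend b i = b ⟨i, hi⟩ := by
  simp [Game.extend, override, hi]

theorem proj_restrict {C C₂ : Finset (Fin N)} (h : C₂ ⊆ C) (a : G.Profile) :
    proj C₂ (restrict C a) = restrict C₂ a := by
  ext i
  simp only [proj, restrict]
  rw [extend_apply_of_mem _ (h i.2)]
  rfl

theorem restrict_extend {C : Finset (Fin N)} (b : G.Local C) : restrict C (Game.extend b) = b := by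
  ext i
  exact extend_apply_of_mem b i.2

theorem exists_proj_eq {C C₂ : Finset (Fin N)} (h : C₂ ⊆ C) (s : G.Local C₂) :
    ∃ b : G.Local C, proj C₂ b = s :=
  ⟨restrict C (Game.extend s), by rw [proj_restrict h, restrict_extend]⟩

theorem card_local_mono {C C₂ : Finset (Fin N)} (h : C₂ ⊆ C) :
    Fintype.card (G.Local C₂) ≤ Fintype.card (G.Local C) :=
  Fintype.card_le_of_surjective (proj C₂) (exists_proj_eq h)

end Game

namespace RootedDecomposition

open Game

variable {N : ℕ} {G : Game N} (D : RootedDecomposition G)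

/-! ### The rooted tree -/

theorem depth_root : D.depth D.root = 0 := SimpleGraph.dist_self

theorem depth_lt (B : Fin D.K) : D.depth B < D.K := by
  obtain ⟨p, hp, hlen⟩ := (D.isTree.connected.preconnected D.root B).exists_path_of_dist
  have := hp.length_lt
  rw [hlen, Fintype.card_fin] at this
  exact this

theorem mem_children {B B₂ : Fin D.K} :
    B₂ ∈ D.children B ↔ D.tree.Adj B B₂ ∧ D.depth B₂ = D.depth B + 1 := by
  simp [children]

/-- Two fathers would extend to two shortest paths from the root to the same bag. A tree has only
one, and the father is its penultimate vertex. -/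
theorem eq_of_mem_children {B B₂ P : Fin D.K} (h : B ∈ D.children P) (h₂ : B ∈ D.children B₂) :
    P = B₂ := by
  rw [mem_children] at h h₂
  obtain ⟨p, hp⟩ := (D.isTree.connected.preconnected D.root P).exists_walk_length_eq_dist
  obtain ⟨q, hq⟩ := (D.isTree.connected.preconnected D.root B₂).exists_walk_length_eq_dist
  have hp' : (p.concat h.1).IsPath := SimpleGraph.Walk.isPath_of_length_eq_dist _ (by
    rw [SimpleGraph.Walk.length_concat, hp]
    exact h.2.symm)
  have hq' : (q.concat h₂.1).IsPath := SimpleGraph.Walk.isPath_of_length_eq_dist _ (by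
    rw [SimpleGraph.Walk.length_concat, hq]
    exact h₂.2.symm)
  have := (D.isTree.existsUnique_path D.root B).unique hp' hq'
  simpa using congrArg SimpleGraph.Walk.penultimate this

theorem exists_mem_children {B : Fin D.K} (hB : B ≠ D.root) : ∃ P, B ∈ D.children P := by
  obtain ⟨p, hp⟩ := (D.isTree.connected.preconnected D.root B).exists_walk_length_eq_dist
  have hnil : ¬ p.Nil := fun h => hB h.eq.symm
  refine ⟨p.penultimate, D.mem_children.mpr ⟨p.adj_penultimate hnil, ?_⟩⟩
  have h1 : D.depth p.penultimate ≤ p.dropLast.length := SimpleGraph.dist_le _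
  have h2 : p.dropLast.length + 1 = p.length := by
    have h3 := congrArg SimpleGraph.Walk.length (p.concat_dropLast (p.adj_penultimate hnil))
    rw [SimpleGraph.Walk.length_concat] at h3
    exact h3
  have h4 := D.isTree.dist_eq_dist_add_one_of_adj D.root (p.adj_penultimate hnil)
  simp only [depth] at h1 ⊢
  omega

theorem mem_children_parent {B : Fin D.K} (hB : B ≠ D.root) : B ∈ D.children (D.parent B) := by
  have h := D.exists_mem_children hB
  rw [parent, dif_pos h]
  exact h.choose_spec

theorem mem_children_iff {B B₂ : Fin D.K} :
    B₂ ∈ D.children B ↔ B₂ ≠ D.root ∧ D.parent B₂ = B := by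
  constructor
  · intro h
    have hne : B₂ ≠ D.root := by
      rintro rfl
      have := (D.mem_children.mp h).2
      rw [D.depth_root] at this
      omega
    exact ⟨hne, D.eq_of_mem_children (D.mem_children_parent hne) h⟩
  · rintro ⟨hne, rfl⟩
    exact D.mem_children_parent hne

theorem depth_parent {B : Fin D.K} (hB : B ≠ D.root) : D.depth B = D.depth (D.parent B) + 1 :=
  (D.mem_children.mp (D.mem_children_parent hB)).2

/-- Every bag except the root is a child of exactly one bag. This serves both the telescoping of the
dynamic program and the count of its steps. -/
theorem sum_children {M : Type*} [AddCommMonoid M] (f : Fin D.K → Fin D.K → M) :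
    ∑ B, ∑ B₂ ∈ D.children B, f B B₂ = ∑ B with B ≠ D.root, f (D.parent B) B := by
  rw [← Finset.sum_fiberwise_of_maps_to (s := Finset.univ.filter fun B => B ≠ D.root)
    (g := D.parent) (t := Finset.univ)
    (fun _ _ => Finset.mem_univ _)]
  refine Finset.sum_congr rfl fun B _ => ?_
  have : D.children B = ((Finset.univ.filter fun B => B ≠ D.root).filter fun B₂ =>
      D.parent B₂ = B) := by
    ext B₂
    simp [D.mem_children_iff]
  rw [this]
  refine Finset.sum_congr rfl fun B₂ hB₂ => ?_
  rw [(Finset.mem_filter.mp hB₂).2]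

theorem sep_subset_bag (B : Fin D.K) : D.sep B ⊆ D.bag B := by
  unfold sep
  split_ifs
  · exact Finset.empty_subset _
  · exact Finset.inter_subset_left

theorem sep_subset_bag_parent (B : Fin D.K) : D.sep B ⊆ D.bag (D.parent B) := by
  unfold sep
  split_ifs
  · exact Finset.empty_subset _
  · exact Finset.inter_subset_right

theorem sep_eq {B : Fin D.K} (hB : B ≠ D.root) : D.sep B = D.bag B ∩ D.bag (D.parent B) :=
  if_neg hB

/-- Agreement of the root with its conventional father, itself, is a void condition; the two passes
therefore treat the root like any other bag. -/
instance : Subsingleton (G.Local (D.sep D.root)) := by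
  have : D.sep D.root = ∅ := if_pos rfl
  rw [this]
  infer_instance

/-- Actions of the bags that agree along the edges of the tree come from a profile. -/
theorem restrict_assemble {x : ∀ B, D.BagAct B}
    (hx : ∀ B, B ≠ D.root → proj (D.sep B) (x B) = proj (D.sep B) (x (D.parent B)))
    (B : Fin D.K) : restrict (D.bag B) (D.assemble x) = x B := by
  have hparent : ∀ (B : Fin D.K) (i : Fin N), B ≠ D.root → ∀ (h : i ∈ D.bag B)
      (h' : i ∈ D.bag (D.parent B)), x B ⟨i, h⟩ = x (D.parent B) ⟨i, h'⟩ := by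
    intro B i hB h h'
    have hi : i ∈ D.sep B := by rw [D.sep_eq hB]; exact Finset.mem_inter.mpr ⟨h, h'⟩
    have := congrFun (hx B hB) ⟨i, hi⟩
    simpa only [proj, restrict, extend_apply_of_mem _ h, extend_apply_of_mem _ h'] using this
  have hadj : ∀ (u v : Fin D.K) (i : Fin N), D.tree.Adj u v → ∀ (h : i ∈ D.bag u)
      (h' : i ∈ D.bag v), x u ⟨i, h⟩ = x v ⟨i, h'⟩ := by
    intro u v i huv h h'
    rcases D.isTree.dist_eq_dist_add_one_of_adj D.root huv with hd | hd
    · obtain ⟨hne, rfl⟩ := D.mem_children_iff.mp (D.mem_children.mpr ⟨huv.symm, hd⟩)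
      exact hparent u i hne h h'
    · obtain ⟨hne, rfl⟩ := D.mem_children_iff.mp (D.mem_children.mpr ⟨huv, hd⟩)
      exact (hparent v i hne h' h).symm
  -- Adjacent bags agree on shared players, and by the path axiom all bags on the path between two
  -- bags containing `i` contain `i`. So the choice of bag in `assemble` is immaterial.
  have hwalk : ∀ (i : Fin N) (u v : Fin D.K) (p : D.tree.Walk u v),
      (∀ w ∈ p.support, i ∈ D.bag w) → ∀ (h : i ∈ D.bag u) (h' : i ∈ D.bag v),
      x u ⟨i, h⟩ = x v ⟨i, h'⟩ := by
    intro i u v p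
    induction p with
    | nil => intro _ _ _; rfl
    | cons hab q ih =>
      intro hs h h'
      have hmid := hs _ (List.mem_cons_of_mem _ q.start_mem_support)
      rw [hadj _ _ i hab h hmid]
      exact ih (fun w hw => hs w (List.mem_cons_of_mem _ hw)) hmid h'
  ext i
  obtain ⟨p, hp, -⟩ := D.isTree.existsUnique_path (D.cover i.1).choose B
  exact hwalk i _ _ p (D.path i _ _ p hp (D.cover i.1).choose_spec i.2) _ _

/-! ### Correctness of the dynamic program -/

/-- The tables at the bag `B` satisfy the equations of the dynamic program. -/
def SolvesAt (w : D.Table) (st : D.UpState) (B : Fin D.K) : Prop :=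
  (∀ a, (st B).1 a = w B a + ∑ B₂ ∈ D.children B, (st B₂).2 (proj (D.sep B₂) a)) ∧
  (∀ a, (st B).1 a ≤ (st B).2 (proj (D.sep B) a)) ∧
  (∀ s, ∃ a, proj (D.sep B) a = s ∧ (st B).2 s = (st B).1 a)

theorem processUp_fst (w : D.Table) (st : D.UpState) (B : Fin D.K) (a : D.BagAct B) :
    (D.processUp w st B).val.1 a =
      w B a + ∑ B₂ ∈ D.children B, (st B₂).2 (proj (D.sep B₂) a) := rfl

theorem processUp_snd (w : D.Table) (st : D.UpState) (B : Fin D.K) (s : G.Local (D.sep B)) :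
    (∀ a, proj (D.sep B) a = s →
      (D.processUp w st B).val.1 a ≤ (D.processUp w st B).val.2 s) ∧
    ∃ a, proj (D.sep B) a = s ∧ (D.processUp w st B).val.2 s = (D.processUp w st B).val.1 a := by
  have hne : (Finset.univ.filter fun a : D.BagAct B => proj (D.sep B) a = s).Nonempty := by
    obtain ⟨b, hb⟩ := exists_proj_eq (D.sep_subset_bag B) s
    exact ⟨b, by simpa using hb⟩
  have h := Timed.argmax_spec hne fun a => Timed.op ((D.processUp w st B).val.1 a)
  refine ⟨fun a ha => h.2 a (by simpa using ha), _, (Finset.mem_filter.mp h.1).2, rfl⟩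

/-- The levels are filled from the deepest up. The children of a bag lie one level deeper, hence are
final when the bag is processed and are not overwritten afterwards. -/
theorem solvesAt_upPass (w : D.Table) (j : ℕ) (hj : j ≤ D.K) (B : Fin D.K)
    (hB : D.K - j ≤ D.depth B) : D.SolvesAt w (D.upPass w j).val B := by
  induction j with
  | zero =>
    have := D.depth_lt B
    omega
  | succ j ih =>
    set st := (D.upPass w j).val with hst
    have hval : ∀ B, (D.upPass w (j + 1)).val B =
        if D.depth B = D.K - 1 - j then (D.processUp w st B).val else st B := by
      intro B
      have : (D.upPass w (j + 1)).val B = if B ∈ (Finset.univ.filter fun B =>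
        D.depth B = D.K - 1 - j) then (D.processUp w st B).val else st B := rfl
      rw [this]
      simp
    have hchild : ∀ B₂ ∈ D.children B, (D.upPass w (j + 1)).val B₂ = st B₂ := by
      intro B₂ hB₂
      have := (D.mem_children.mp hB₂).2
      rw [hval, if_neg (by omega)]
    by_cases hd : D.depth B = D.K - 1 - j
    · refine ⟨fun a => ?_, fun a => ?_, fun s => ?_⟩
      · rw [Finset.sum_congr rfl fun B₂ hB₂ => by rw [hchild B₂ hB₂], hval, if_pos hd,
          D.processUp_fst]
      · rw [hval, if_pos hd]
        exact (D.processUp_snd w st B _).1 a rfl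
      · rw [hval, if_pos hd]
        exact (D.processUp_snd w st B s).2
    · obtain ⟨h1, h2, h3⟩ := ih (by omega) (by omega)
      have hB' : (D.upPass w (j + 1)).val B = st B := by rw [hval, if_neg hd]
      refine ⟨fun a => ?_, fun a => ?_, fun s => ?_⟩
      · rw [Finset.sum_congr rfl fun B₂ hB₂ => by rw [hchild B₂ hB₂], hB']
        exact h1 a
      · rw [hB']
        exact h2 a
      · rw [hB']
        exact h3 s

/-- A father lies one level higher, so writing level `j` leaves the fathers of its bags and all
earlier choices unchanged. -/
theorem downPass_spec (st : D.UpState) (j : ℕ) (B : Fin D.K) (hB : D.depth B < j) :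
    proj (D.sep B) ((D.downPass st j).val B) =
      proj (D.sep B) ((D.downPass st j).val (D.parent B)) ∧
    ∀ b, proj (D.sep B) b = proj (D.sep B) ((D.downPass st j).val B) →
      (st B).1 b ≤ (st B).1 ((D.downPass st j).val B) := by
  induction j with
  | zero => omega
  | succ j ih =>
    set x := (D.downPass st j).val with hx
    have hval : ∀ B, (D.downPass st (j + 1)).val B =
        if D.depth B = j then (Timed.argmax
          (Finset.univ.filter fun b : D.BagAct B =>
            proj (D.sep B) b = proj (D.sep B) (x (D.parent B)))
          fun b => Timed.op ((st B).1 b)).val else x B := by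
      intro B
      have : (D.downPass st (j + 1)).val B =
        if B ∈ (Finset.univ.filter fun B => D.depth B = j) then (Timed.argmax
          (Finset.univ.filter fun b : D.BagAct B =>
            proj (D.sep B) b = proj (D.sep B) (x (D.parent B)))
          fun b => Timed.op ((st B).1 b)).val else x B := rfl
      rw [this]
      simp
    have hpar : D.depth B ≤ j → proj (D.sep B) ((D.downPass st (j + 1)).val (D.parent B)) =
        proj (D.sep B) (x (D.parent B)) := by
      intro hle
      by_cases hr : B = D.root
      · subst hr
        exact Subsingleton.elim _ _
      · have := D.depth_parent hr
        rw [hval, if_neg (by omega)]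
    rw [hpar (by omega)]
    by_cases hd : D.depth B = j
    · have hne : (Finset.univ.filter fun b : D.BagAct B =>
          proj (D.sep B) b = proj (D.sep B) (x (D.parent B))).Nonempty := by
        obtain ⟨b, hb⟩ := exists_proj_eq (D.sep_subset_bag B) (proj (D.sep B) (x (D.parent B)))
        exact ⟨b, by simpa using hb⟩
      have h := Timed.argmax_spec hne fun b => Timed.op ((st B).1 b)
      have h1 := (Finset.mem_filter.mp h.1).2
      rw [hval, if_pos hd]
      exact ⟨h1, fun b hb => h.2 b (by simpa using hb.trans h1)⟩
    · rw [hval, if_neg hd]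
      exact ih (by omega)

/-- Telescoping of the dynamic program along the tree. -/
theorem sum_table_eq {w : D.Table} {st : D.UpState} (hst : ∀ B, D.SolvesAt w st B)
    (y : ∀ B, D.BagAct B) :
    ∑ B, w B (y B) = (st D.root).1 (y D.root) + ∑ B with B ≠ D.root,
      ((st B).1 (y B) - (st B).2 (proj (D.sep B) (y (D.parent B)))) := by
  have h1 : ∀ B, w B (y B) =
      (st B).1 (y B) - ∑ B₂ ∈ D.children B, (st B₂).2 (proj (D.sep B₂) (y B)) := by
    intro B
    rw [(hst B).1]
    ring
  -- Each message subtracted at a father is charged to the child that sent it, pairing it with the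
  -- table value of that child.
  rw [Finset.sum_congr rfl fun B _ => h1 B, Finset.sum_sub_distrib,
    D.sum_children fun B B₂ => (st B₂).2 (proj (D.sep B₂) (y B)), Finset.sum_sub_distrib,
    ← Finset.add_sum_erase Finset.univ _ (Finset.mem_univ D.root), Finset.filter_ne']
  ring

/-- The dynamic program maximizes the total over all profiles. -/
theorem treeDP_spec (w : D.Table) :
    (∀ B, (D.treeDP w).val.2 B = restrict (D.bag B) (D.assemble (D.treeDP w).val.2)) ∧
    (D.treeDP w).val.1 = ∑ B, w B ((D.treeDP w).val.2 B) ∧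
    ∀ a : G.Profile, ∑ B, w B (restrict (D.bag B) a) ≤ (D.treeDP w).val.1 := by
  set st := (D.upPass w D.K).val with hst_def
  have hst : ∀ B, D.SolvesAt w st B := fun B =>
    D.solvesAt_upPass w D.K le_rfl B (by omega)
  set x := (D.downPass st D.K).val with hx_def
  have hx : ∀ B, proj (D.sep B) (x B) = proj (D.sep B) (x (D.parent B)) ∧
      ∀ b, proj (D.sep B) b = proj (D.sep B) (x B) → (st B).1 b ≤ (st B).1 (x B) :=
    fun B => D.downPass_spec st D.K B (D.depth_lt B)
  have h2 : (D.treeDP w).val.2 = x := rfl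
  have h1 : (D.treeDP w).val.1 = (st D.root).1 (x D.root) := rfl
  rw [h1, h2]
  refine ⟨fun B => (D.restrict_assemble (fun B _ => (hx B).1) B).symm, ?_, fun a => ?_⟩
  -- For the reconstructed actions each edge term vanishes: the action of the child attains the
  -- maximum that its message records.
  · rw [D.sum_table_eq hst x, Finset.sum_eq_zero, add_zero]
    intro B _
    rw [← (hx B).1, sub_eq_zero]
    refine le_antisymm ((hst B).2.1 (x B)) ?_
    obtain ⟨b, hb, hval⟩ := (hst B).2.2 (proj (D.sep B) (x B))
    rw [hval]
    exact (hx B).2 b hb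
  · rw [D.sum_table_eq hst fun B => restrict (D.bag B) a]
    have hroot := (hx D.root).2 (restrict (D.bag D.root) a) (Subsingleton.elim _ _)
    -- For any profile, a message dominates the table value of every compatible action, so edge
    -- terms are nonpositive.
    have hle : ∑ B with B ≠ D.root, ((st B).1 (restrict (D.bag B) a) -
        (st B).2 (proj (D.sep B) (restrict (D.bag (D.parent B)) a))) ≤ 0 := by
      refine Finset.sum_nonpos fun B _ => ?_
      rw [proj_restrict (D.sep_subset_bag_parent B), ← proj_restrict (D.sep_subset_bag B),
        sub_nonpos]
      exact (hst B).2.1 _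
    linarith

end RootedDecomposition

namespace RootedDecomposition

open Game

variable {N : ℕ} {G : Game N} (D : RootedDecomposition G)

/-! ### The algorithm follows the dynamics -/

section Correctness

variable (ξ : D.NoiseIndex → ℝ)

/-- The perturbed table of the correlator. -/
def corrTable (t : ℕ) (M : D.Memory) : D.Table := fun B a => ξ (.corr t B a) - M.loss B a

/-- The perturbed table of the deviator for one coalition. -/
def devTable (t : ℕ) (M : D.Memory) (S : G.Coalition) : D.Table :=
  fun B b => M.gain S B b + ξ (.dev t S B b)

theorem playRound_spec (t : ℕ) (M : D.Memory) :
    ∃ z : D.Play, (D.playRound ξ t M).val.hist = Function.update M.hist t z ∧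
      z.base = (D.treeDP (D.corrTable ξ t M)).val.2 ∧
      z.devi = (D.treeDP (D.devTable ξ t M z.coal)).val.2 ∧
      (∀ S, (D.treeDP (D.devTable ξ t M S)).val.1 ≤
        (D.treeDP (D.devTable ξ t M z.coal)).val.1) ∧
      (∀ B a, (D.playRound ξ t M).val.loss B a =
        M.loss B a + D.bagGain z.coal B (z.devi B) a) ∧
      (∀ S B b, (D.playRound ξ t M).val.gain S B b =
        M.gain S B b + D.bagGain S B b (z.base B)) := by
  have h := Timed.argmax_spec (Finset.univ_nonempty (α := G.Coalition))
    fun S => Timed.op (D.treeDP (D.devTable ξ t M S)).val.1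
  exact ⟨⟨_, _, _⟩, rfl, rfl, rfl, fun S => h.2 S (Finset.mem_univ S), fun _ _ => rfl,
    fun _ _ _ => rfl⟩

/-- The play of round `t` of the algorithm. -/
def playOf (t : ℕ) : D.Play := (D.run ξ (t + 1)).val.hist t

/-- The plays of the algorithm as a history. -/
def playHistory : History G :=
  fun t => ((D.playOf ξ t).profile, ((D.playOf ξ t).coal, D.assemble (D.playOf ξ t).devi))

theorem run_succ_val (t : ℕ) :
    (D.run ξ (t + 1)).val = (D.playRound ξ t (D.run ξ t).val).val := rfl

theorem run_spec (t : ℕ) :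
    (∀ s, s ≠ t → (D.run ξ (t + 1)).val.hist s = (D.run ξ t).val.hist s) ∧
    (D.playOf ξ t).base = (D.treeDP (D.corrTable ξ t (D.run ξ t).val)).val.2 ∧
    (D.playOf ξ t).devi =
      (D.treeDP (D.devTable ξ t (D.run ξ t).val (D.playOf ξ t).coal)).val.2 ∧
    (∀ S, (D.treeDP (D.devTable ξ t (D.run ξ t).val S)).val.1 ≤
      (D.treeDP (D.devTable ξ t (D.run ξ t).val (D.playOf ξ t).coal)).val.1) ∧
    (∀ B a, (D.run ξ (t + 1)).val.loss B a = (D.run ξ t).val.loss B a +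
      D.bagGain (D.playOf ξ t).coal B ((D.playOf ξ t).devi B) a) ∧
    (∀ S B b, (D.run ξ (t + 1)).val.gain S B b = (D.run ξ t).val.gain S B b +
      D.bagGain S B b ((D.playOf ξ t).base B)) := by
  obtain ⟨z, h1, h2, h3, h4, h5, h6⟩ := D.playRound_spec ξ t (D.run ξ t).val
  have hz : D.playOf ξ t = z := by
    rw [playOf, run_succ_val, h1, Function.update_self]
  rw [hz]
  refine ⟨fun s hs => ?_, h2, h3, h4, h5, h6⟩
  rw [run_succ_val, h1, Function.update_of_ne hs]

theorem hist_run {T s : ℕ} (hs : s < T) : (D.run ξ T).val.hist s = D.playOf ξ s := by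
  induction T with
  | zero => omega
  | succ T ih =>
    rcases Nat.lt_succ_iff_lt_or_eq.mp hs with h | rfl
    · rw [(D.run_spec ξ T).1 s h.ne, ih h]
    · rfl

theorem loss_run (t : ℕ) (B : Fin D.K) (a : D.BagAct B) :
    (D.run ξ t).val.loss B a = ∑ s ∈ Finset.range t,
      D.bagGain (D.playOf ξ s).coal B ((D.playOf ξ s).devi B) a := by
  induction t with
  | zero => rfl
  | succ t ih => rw [(D.run_spec ξ t).2.2.2.2.1, ih, Finset.sum_range_succ]

theorem gain_run (t : ℕ) (S : G.Coalition) (B : Fin D.K) (b : D.BagAct B) :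
    (D.run ξ t).val.gain S B b = ∑ s ∈ Finset.range t,
      D.bagGain S B b ((D.playOf ξ s).base B) := by
  induction t with
  | zero => rfl
  | succ t ih => rw [(D.run_spec ξ t).2.2.2.2.2, ih, Finset.sum_range_succ]

theorem base_eq (t : ℕ) (B : Fin D.K) :
    (D.playOf ξ t).base B = restrict (D.bag B) (D.playOf ξ t).profile := by
  rw [Play.profile, (D.run_spec ξ t).2.1]
  exact (D.treeDP_spec _).1 B

theorem devi_eq (t : ℕ) (B : Fin D.K) :
    (D.playOf ξ t).devi B = restrict (D.bag B) (D.assemble (D.playOf ξ t).devi) := by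
  rw [(D.run_spec ξ t).2.2.1]
  exact (D.treeDP_spec _).1 B

/-- The past plays stored bag by bag are restrictions of actual profiles (`devi_eq`), so the
accumulated bag gains add up to true gains and the table total is the objective of the perturbed
leader. -/
theorem corr_value_eq (t : ℕ) (a : G.Profile) :
    corrReward (D.playHistory ξ) t a + perturb D.corrOption (D.corrBlock ξ t) a =
      ∑ B, D.corrTable ξ t (D.run ξ t).val B (restrict (D.bag B) a) := by
  simp only [corrTable, Finset.sum_sub_distrib, loss_run, corrReward, Finset.sum_apply,
    Pi.neg_apply, Finset.sum_neg_distrib, playHistory, D.devGain_toDeviation, ← devi_eq]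
  rw [Finset.sum_comm, neg_add_eq_sub]
  rfl

theorem dev_value_eq (t : ℕ) (e : G.Coalition × G.Profile) :
    devReward (D.playHistory ξ) t e + perturb D.devOption (D.devBlock ξ t) e =
      ∑ B, D.devTable ξ t (D.run ξ t).val e.1 B (restrict (D.bag B) e.2) := by
  simp only [devTable, Finset.sum_add_distrib, gain_run, devReward, Finset.sum_apply,
    playHistory, D.devGain_toDeviation, ← base_eq]
  rw [Finset.sum_comm]
  rfl

/-- For the deviator, the best profile for each coalition followed by the best coalition is a
maximum over all pairs. -/
theorem leadersUpTo_playHistory (T : ℕ) : D.LeadersUpTo ξ (D.playHistory ξ) T := by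
  intro t _
  obtain ⟨-, h2, h3, h4, -, -⟩ := D.run_spec ξ t
  constructor
  · intro a
    rw [D.corr_value_eq, D.corr_value_eq]
    obtain ⟨-, g2, g3⟩ := D.treeDP_spec (D.corrTable ξ t (D.run ξ t).val)
    refine (g3 a).trans_eq (g2.trans ?_)
    rw [← h2]
    exact Finset.sum_congr rfl fun B _ => by rw [D.base_eq]; rfl
  · intro e
    rw [D.dev_value_eq, D.dev_value_eq]
    refine ((D.treeDP_spec (D.devTable ξ t (D.run ξ t).val e.1)).2.2 e.2).trans
      ((h4 e.1).trans_eq ((D.treeDP_spec _).2.1.trans ?_))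
    rw [← h3]
    exact Finset.sum_congr rfl fun B _ => by rw [D.devi_eq]; rfl

/-- The plays of the algorithm follow the perturbed leader. -/
theorem followsFTPL_run (T : ℕ) : D.FollowsFTPL ξ T (D.outCorr ξ T) (D.outDev ξ T) := by
  have hplay : ∀ s < T, D.outCorr ξ T s = pureStrategy (D.playHistory ξ s).1 ∧
      D.outDev ξ T s = pureStrategy (toDeviation (D.playHistory ξ s).2) := by
    intro s hs
    rw [outCorr, outDev, D.hist_run ξ hs]
    exact ⟨rfl, rfl⟩
  intro t ht
  rw [(hplay t ht).1, (hplay t ht).2]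
  obtain ⟨ha, he⟩ := D.leadersUpTo_playHistory ξ T t ht
  exact D.round_of_isLeader ξ (fun s hs => hplay s (hs.trans ht)) ha he

end Correctness

/-! ### Running time -/

section Cost

/-- A bound on the number of joint actions of a bag. -/
def bagSize : ℕ := G.maxActions ^ (D.width + 1)

theorem card_bagAct_le (B : Fin D.K) : Fintype.card (D.BagAct B) ≤ D.bagSize :=
  (card_local_le _).trans (Nat.pow_le_pow_right G.maxActions_pos (D.card_bag_le B))

theorem bagSize_pos : 0 < D.bagSize := pow_pos G.maxActions_pos _

theorem bags_pos : 0 < D.K := D.root.pos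

theorem sum_card_children_le : ∑ B, (D.children B).card ≤ D.K := by
  simp only [Finset.card_eq_sum_ones]
  rw [D.sum_children fun _ _ => 1, ← Finset.card_eq_sum_ones]
  exact (Finset.card_filter_le _ _).trans (by simp)

/-- The searches for the message entries run over the fibres of `proj`, which partition the actions
of the bag. Together they cost one scan of the table, not a product of two table sizes. -/
theorem steps_processUp_le (w : D.Table) (st : D.UpState) (B : Fin D.K) :
    (D.processUp w st B).steps ≤ D.bagSize * (7 + 2 * (D.children B).card) := by
  have h1 : (D.processUp w st B).steps =
      ∑ _a : D.BagAct B, (1 + (∑ _B₂ ∈ D.children B, 2 + 1) + 1) +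
      (∑ s : G.Local (D.sep B),
        (∑ _a ∈ Finset.univ.filter (fun a : D.BagAct B => proj (D.sep B) a = s), 2 + 1 + 1)
        + 0) := rfl
  have h2 : ∑ s : G.Local (D.sep B),
      ∑ _a ∈ Finset.univ.filter (fun a : D.BagAct B => proj (D.sep B) a = s), 2 =
      ∑ _a : D.BagAct B, 2 :=
    Finset.sum_fiberwise _ _ _
  rw [h1]
  simp only [Finset.sum_add_distrib, h2]
  simp only [Finset.sum_const, smul_eq_mul, Finset.card_univ]
  have h3 := D.card_bagAct_le B
  have h4 := (card_local_mono (G := G) (D.sep_subset_bag B)).trans h3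
  nlinarith

theorem steps_upPass (w : D.Table) (c : Fin D.K → ℕ)
    (hc : ∀ st B, (D.processUp w st B).steps + 1 ≤ c B) (j : ℕ) :
    (D.upPass w j).steps ≤
      ∑ i ∈ Finset.range j, (1 + ∑ B with D.depth B = D.K - 1 - i, c B) := by
  induction j with
  | zero => exact Nat.zero_le _
  | succ j ih =>
    rw [Finset.sum_range_succ]
    have h : (D.upPass w (j + 1)).steps = (D.upPass w j).steps +
      (1 + ∑ B with D.depth B = D.K - 1 - j,
        ((D.processUp w (D.upPass w j).val B).steps + 1)) := rfl
    rw [h]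
    exact add_le_add ih (add_le_add le_rfl (Finset.sum_le_sum fun B _ => hc _ B))

theorem sum_levels (c : Fin D.K → ℕ) :
    ∑ i ∈ Finset.range D.K, ∑ B with D.depth B = i, c B = ∑ B, c B :=
  Finset.sum_fiberwise_of_maps_to (fun B _ => Finset.mem_range.mpr (D.depth_lt B)) c

theorem steps_upPass_le (w : D.Table) : (D.upPass w D.K).steps ≤ 11 * (D.bagSize * D.K) := by
  refine (D.steps_upPass w (fun B => D.bagSize * (7 + 2 * (D.children B).card) + 1)
    (fun st B => Nat.succ_le_succ (D.steps_processUp_le w st B)) D.K).trans ?_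
  rw [Finset.sum_add_distrib, Finset.sum_range_reflect
    (fun i => ∑ B with D.depth B = i, (D.bagSize * (7 + 2 * (D.children B).card) + 1)),
    D.sum_levels, Finset.sum_add_distrib, ← Finset.mul_sum, Finset.sum_add_distrib,
    ← Finset.mul_sum]
  simp only [Finset.sum_const, Finset.card_range, Finset.card_univ, Fintype.card_fin, smul_eq_mul]
  have h1 := D.sum_card_children_le
  have h2 := D.bagSize_pos
  nlinarith [Nat.mul_le_mul_left D.bagSize h1]

theorem steps_downPass (st : D.UpState) (j : ℕ) :
    (D.downPass st j).steps ≤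
      ∑ i ∈ Finset.range j, (1 + ∑ B with D.depth B = i, (2 + 2 * D.bagSize)) := by
  induction j with
  | zero => exact Nat.zero_le _
  | succ j ih =>
    rw [Finset.sum_range_succ]
    set x := (D.downPass st j).val
    have h : (D.downPass st (j + 1)).steps = (D.downPass st j).steps +
      (1 + ∑ B with D.depth B = j, (1 + ∑ _b ∈ Finset.univ.filter (fun b : D.BagAct B =>
        proj (D.sep B) b = proj (D.sep B) (x (D.parent B))), (1 + 1) + 1)) := rfl
    rw [h]
    refine add_le_add ih (add_le_add le_rfl (Finset.sum_le_sum fun B _ => ?_))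
    rw [Finset.sum_const, smul_eq_mul]
    have h1 : (Finset.univ.filter (fun b : D.BagAct B =>
        proj (D.sep B) b = proj (D.sep B) (x (D.parent B)))).card ≤ D.bagSize :=
      (Finset.card_le_univ _).trans (D.card_bagAct_le B)
    omega

theorem steps_downPass_le (st : D.UpState) :
    (D.downPass st D.K).steps ≤ 5 * (D.bagSize * D.K) := by
  refine (D.steps_downPass st D.K).trans ?_
  rw [Finset.sum_add_distrib, D.sum_levels]
  simp only [Finset.sum_const, Finset.card_range, Finset.card_univ, Fintype.card_fin, smul_eq_mul]
  have := D.bagSize_pos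
  nlinarith

theorem steps_treeDP_le (w : D.Table) : (D.treeDP w).steps ≤ 17 * (D.bagSize * D.K) := by
  have h : (D.treeDP w).steps = (D.upPass w D.K).steps +
    ((D.downPass (D.upPass w D.K).val D.K).steps + (1 + 0)) := rfl
  have h1 := D.steps_upPass_le w
  have h2 := D.steps_downPass_le (D.upPass w D.K).val
  have h3 : 0 < D.bagSize * D.K := Nat.mul_pos D.bagSize_pos D.bags_pos
  omega

theorem evals_treeDP (w : D.Table) : (D.treeDP w).evals = 0 := by
  have hproc : ∀ st B, (D.processUp w st B).evals = 0 := by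
    intro st B
    simp [processUp]
  have hup : ∀ j, (D.upPass w j).evals = 0 := by
    intro j
    induction j with
    | zero => rfl
    | succ j ih => simp [upPass, ih, hproc]
  have hdown : ∀ st j, (D.downPass st j).evals = 0 := by
    intro st j
    induction j with
    | zero => rfl
    | succ j ih => simp [downPass, ih]
  simp [treeDP, hup, hdown]

/-- The cost of filling a table, given the cost of an entry. -/
theorem sum_bagAct_le {f : ∀ B, D.BagAct B → ℕ} {c : ℕ} (hf : ∀ B a, f B a + 1 ≤ c) :
    ∑ B, (∑ a, (f B a + 1) + 1) ≤ (c + 1) * (D.bagSize * D.K) := by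
  calc ∑ B, (∑ a, (f B a + 1) + 1) ≤ ∑ _B : Fin D.K, (c + 1) * D.bagSize := by
        refine Finset.sum_le_sum fun B _ => ?_
        have h1 : ∑ a, (f B a + 1) ≤ ∑ _a : D.BagAct B, c := Finset.sum_le_sum fun a _ => hf B a
        rw [Finset.sum_const, Finset.card_univ, smul_eq_mul] at h1
        have h2 := D.card_bagAct_le B
        have h3 := D.bagSize_pos
        nlinarith
    _ = _ := by
        simp only [Finset.sum_const, Finset.card_univ, Fintype.card_fin, smul_eq_mul]
        ring

theorem sum_coalition_le {f : G.Coalition → ℕ} {c : ℕ} (hf : ∀ S, f S ≤ c) :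
    ∑ S, f S ≤ G.coalitions.card * c := by
  calc ∑ S, f S ≤ ∑ _S : G.Coalition, c := Finset.sum_le_sum fun S _ => hf S
    _ = _ := by simp

theorem coalitions_card_pos : 0 < G.coalitions.card := G.coalitions_nonempty.card_pos

theorem steps_zeroMemory_le :
    D.zeroMemory.steps ≤ 7 * (G.coalitions.card * (D.bagSize * D.K)) := by
  have h : D.zeroMemory.steps = ∑ B, (∑ _a : D.BagAct B, (1 + 1) + 1) +
      (∑ _S : G.Coalition, (∑ B, (∑ _a : D.BagAct B, (1 + 1) + 1) + 1) + 0) := rfl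
  have h1 := D.sum_bagAct_le (f := fun B _ => 1) (c := 2) fun _ _ => le_rfl
  have h0 : 0 < D.bagSize * D.K := Nat.mul_pos D.bagSize_pos D.bags_pos
  have h2 : ∑ _S : G.Coalition, (∑ B, (∑ _a : D.BagAct B, (1 + 1) + 1) + 1) ≤
      G.coalitions.card * (4 * (D.bagSize * D.K)) :=
    sum_coalition_le fun _ => by omega
  have h3 := coalitions_card_pos (G := G)
  rw [h]
  nlinarith

theorem steps_playRound_le (ξ : D.NoiseIndex → ℝ) (t : ℕ) (M : D.Memory) :
    (D.playRound ξ t M).steps ≤ 62 * (G.coalitions.card * (D.bagSize * D.K)) := by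
  have h : (D.playRound ξ t M).steps =
      ∑ B, (∑ _a : D.BagAct B, (1 + (1 + 1) + 1) + 1) +
      ((D.treeDP (D.corrTable ξ t M)).steps +
      (∑ S : G.Coalition, ((∑ B, (∑ _b : D.BagAct B, (1 + (1 + 1) + 1) + 1) +
        (D.treeDP (D.devTable ξ t M S)).steps) + 1) +
      (∑ _S : G.Coalition, (1 + 1) +
      (1 +
      (∑ B, (∑ _a : D.BagAct B, (1 + (1 + (1 + 1)) + 1) + 1) +
      (∑ _S : G.Coalition, (∑ B, (∑ _b : D.BagAct B, (1 + (1 + (1 + 1)) + 1) + 1) + 1) +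
      (1 + 0))))))) := rfl
  have h0 : 0 < D.bagSize * D.K := Nat.mul_pos D.bagSize_pos D.bags_pos
  have hS := coalitions_card_pos (G := G)
  have h1 := D.sum_bagAct_le (f := fun B _ => 1 + (1 + 1)) (c := 4) fun _ _ => le_rfl
  have h2 := D.sum_bagAct_le (f := fun B _ => 1 + (1 + (1 + 1))) (c := 5) fun _ _ => le_rfl
  have h3 := D.steps_treeDP_le (D.corrTable ξ t M)
  have h4 : ∑ S : G.Coalition, ((∑ B, (∑ _b : D.BagAct B, (1 + (1 + 1) + 1) + 1) +
      (D.treeDP (D.devTable ξ t M S)).steps) + 1) ≤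
      G.coalitions.card * (23 * (D.bagSize * D.K)) :=
    sum_coalition_le fun S => by
      have := D.steps_treeDP_le (D.devTable ξ t M S)
      omega
  have h5 : ∑ _S : G.Coalition, (∑ B, (∑ _b : D.BagAct B, (1 + (1 + (1 + 1)) + 1) + 1) + 1) ≤
      G.coalitions.card * (7 * (D.bagSize * D.K)) :=
    sum_coalition_le fun _ => by omega
  have h6 : ∑ _S : G.Coalition, (1 + 1) ≤ G.coalitions.card * (2 * (D.bagSize * D.K)) :=
    sum_coalition_le fun _ => by omega
  rw [h]
  nlinarith [Nat.mul_le_mul hS (le_refl (D.bagSize * D.K))]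

theorem steps_run_le (ξ : D.NoiseIndex → ℝ) (T : ℕ) :
    (D.run ξ T).steps ≤ (62 * T + 7) * (G.coalitions.card * (D.bagSize * D.K)) := by
  induction T with
  | zero => simpa [run] using D.steps_zeroMemory_le
  | succ T ih =>
    have h : (D.run ξ (T + 1)).steps =
      (D.run ξ T).steps + (D.playRound ξ T (D.run ξ T).val).steps := rfl
    rw [h]
    have := D.steps_playRound_le ξ T (D.run ξ T).val
    nlinarith

/-- Each member of the coalition is assigned to one bag only, so the number of bags does not enter
the count. -/
theorem sum_evals_le (S : G.Coalition) :
    ∑ B, ∑ _a : D.BagAct B, 2 * (S.1.filter fun i => D.assign i = B).card ≤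
      2 * (N * D.bagSize) := by
  calc _ ≤ ∑ B, D.bagSize * (2 * (S.1.filter fun i => D.assign i = B).card) := by
        refine Finset.sum_le_sum fun B _ => ?_
        rw [Finset.sum_const, Finset.card_univ, smul_eq_mul]
        exact Nat.mul_le_mul_right _ (D.card_bagAct_le B)
    _ = D.bagSize * (2 * S.1.card) := by
        rw [← Finset.mul_sum, ← Finset.mul_sum,
          ← Finset.card_eq_sum_card_fiberwise (t := Finset.univ) fun _ _ => by simp]
    _ ≤ D.bagSize * (2 * N) := by
        have : S.1.card ≤ N := by simpa using Finset.card_le_univ S.1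
        exact Nat.mul_le_mul_left _ (Nat.mul_le_mul_left _ this)
    _ = _ := by ring

theorem evals_playRound_le (ξ : D.NoiseIndex → ℝ) (t : ℕ) (M : D.Memory) :
    (D.playRound ξ t M).evals ≤ 4 * (G.coalitions.card * (N * D.bagSize)) := by
  have h : ∃ S₀ : G.Coalition, (D.playRound ξ t M).evals =
      ∑ B, ∑ _a : D.BagAct B, 2 * (S₀.1.filter fun i => D.assign i = B).card +
      ∑ S : G.Coalition, ∑ B, ∑ _b : D.BagAct B,
        2 * (S.1.filter fun i => D.assign i = B).card := by
    refine ⟨(Timed.argmax Finset.univ fun S =>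
      Timed.op (D.treeDP (D.devTable ξ t M S)).val.1).val, ?_⟩
    simp only [playRound, Timed.evals_bind, Timed.evals_tabulate, Timed.evals_op,
      Timed.evals_argmax, Timed.evals_pure, evals_treeDP, queryGain, Finset.sum_const_zero,
      add_zero, zero_add]
    rfl
  obtain ⟨S₀, h⟩ := h
  have h1 := D.sum_evals_le S₀
  have h2 := sum_coalition_le D.sum_evals_le
  have h3 := coalitions_card_pos (G := G)
  rw [h]
  nlinarith

theorem evals_run_le (ξ : D.NoiseIndex → ℝ) (T : ℕ) :
    (D.run ξ T).evals ≤ 4 * (T * (G.coalitions.card * (N * D.bagSize))) := by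
  induction T with
  | zero => simp [run, zeroMemory]
  | succ T ih =>
    have h : (D.run ξ (T + 1)).evals =
      (D.run ξ T).evals + (D.playRound ξ T (D.run ξ T).val).evals := rfl
    rw [h]
    have := D.evals_playRound_le ξ T (D.run ξ T).val
    nlinarith

end Cost

end RootedDecomposition

end MASE

end

/-! ### Assembly of the theorem. -/

theorem mainTheorem4 :
    ∃ C : ℝ, 0 < C ∧
      ∀ (N : ℕ) (G : MASE.Game N) (D : MASE.RootedDecomposition G),
        D.width = MASE.treewidth G.depGraph →
      ∀ T : ℕ, 0 < T →
        -- high-probability guarantees of the perturbed-leader dynamics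
        (∀ (Ω : Type*) [MeasurableSpace Ω] (P : Measure Ω) [IsProbabilityMeasure P]
            (η δ : ℝ) (ξ : D.NoiseIndex → Ω → ℝ)
            (p : ℕ → Ω → G.Profile → ℝ) (m : ℕ → Ω → G.Deviation → ℝ),
          0 < η → 0 < δ →
          (∀ k, HasLaw (ξ k) (expMeasure η) P) → iIndepFun ξ P →
          (∀ᵐ ω ∂P, D.FollowsFTPL (fun k => ξ k ω) T (fun t => p t ω) (fun t => m t ω)) →
          (∀ pStar mStar, MASE.Game.IsMinMaxSolution (G := G) pStar mStar →
            ENNReal.ofReal (1 - δ) ≤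
              P {ω | ∀ mHat ∈ stdSimplex ℝ G.Deviation,
                MASE.Game.payoff (MASE.average T fun t => p t ω) mHat ≤
                  MASE.Game.payoff pStar mStar
                    + 4 * D.K * ((1 + (MASE.treewidth G.depGraph + 1) * Real.log G.maxActions)
                        / (η * T))
                    + 4 * η * D.K
                    + 2 * √(2 * Real.log (2 / δ) / T)}) ∧
          (η = 1 / √T →
            ENNReal.ofReal (1 - δ) ≤
              P {ω | MASE.Game.IsApproxMASE
                (C * ((D.K * (MASE.treewidth G.depGraph + 1) * Real.log G.maxActions
                  + √(Real.log (2 / δ))) / √T))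
                (MASE.average T fun t => p t ω)})) ∧
        -- the dynamic programming algorithm implements the dynamics, within the time bound
        (∀ ξ : D.NoiseIndex → ℝ,
          D.FollowsFTPL ξ T (D.outCorr ξ T) (D.outDev ξ T) ∧
          ((D.run ξ T).steps : ℝ) ≤
            C * (T * G.coalitions.card * D.K * G.maxActions ^ (MASE.treewidth G.depGraph + 1)) ∧
          (D.run ξ T).evals ≤
            4 * (T * G.coalitions.card * N * G.maxActions ^ (MASE.treewidth G.depGraph + 1))) := by
  -- The constant must exceed `20` for the approximation guarantee and `69` for the running time.
  refine ⟨100, by norm_num, fun N G D hD T hT => ⟨?_, fun ξ =>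
    ⟨D.followsFTPL_run ξ T, ?_, ?_⟩⟩⟩
  · intro Ω _ P _ η δ ξ p m hη hδ hlaw hind hf
    -- For `δ > 1` the required probability is zero; otherwise `Real.log (2 / δ)` is nonnegative.
    rcases le_or_gt δ 1 with hδ1 | hδ1
    · have hprob := D.measure_exists_history hη hlaw hind hT hδ (by linarith) hf
      rw [← hD]
      refine ⟨fun pStar mStar hs => hprob.trans (measure_mono ?_),
        fun hηT => hprob.trans (measure_mono ?_)⟩
      · rintro ω ⟨h, hp, hsur⟩ mHat hm
        exact D.payoff_average_le_of_surplus_le hη hT hp hsur hs hm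
      · rintro ω ⟨h, hp, hsur⟩
        subst hηT
        exact D.isApproxMASE_of_surplus_le (by norm_num) hT hp hsur
    · rw [ENNReal.ofReal_of_nonpos (by linarith)]
      exact ⟨fun _ _ _ => zero_le, fun _ => zero_le⟩
  · rw [← hD]
    -- As `T ≥ 1`, the cost `7` of the initialization is absorbed into the rounds: `62 * T + 7 ≤ 69
    -- * T`.
    have h1 : (D.run ξ T).steps ≤ 69 * (T * (G.coalitions.card * (D.bagSize * D.K))) := by
      have := D.steps_run_le ξ T
      nlinarith [Nat.mul_le_mul_right (G.coalitions.card * (D.bagSize * D.K)) hT]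
    have h2 : ((D.run ξ T).steps : ℝ) ≤
        69 * (T * (G.coalitions.card * ((G.maxActions : ℝ) ^ (D.width + 1) * D.K))) := by
      simpa [MASE.RootedDecomposition.bagSize] using (Nat.cast_le (α := ℝ)).mpr h1
    have h3 : (0 : ℝ) ≤ T * (G.coalitions.card * ((G.maxActions : ℝ) ^ (D.width + 1) * D.K)) := by
      positivity
    linarith
  · rw [← hD]
    refine (D.evals_run_le ξ T).trans_eq ?_
    rw [MASE.RootedDecomposition.bagSize]
    ring
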